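/- Let $n\ge 2$ and consider $n$ fermionic modes, each held by a different party, with annihilation operators $b_1,\dots,b_n$ acting on the $2^n$-dimensional Fock space, Majorana operators $\tilde c_{2k-1}=b_k+b_k^\dagger$, $\tilde c_{2k}=-i(b_k-b_k^\dagger)$, and parity operator $P=(-1)^{\sum_k b_k^\dagger b_k}$. A pure fermionic state is a unit vector $|\Psi\rangle$ whose projector commutes with $P$. It is fully entangled if for no nonempty proper subset $S$ of the modes one has $|\Psi\rangle\langle\Psi|=\rho_S\rho_{S^c}$ with positive semidefinite operators $\rho_S,\rho_{S^c}$ that commute with $P$ and lie in the algebras generated by the Majorana operators of the modes in $S$ and in $S^c$, respectively. On $N$ modes, a Gaussian state is a density operator of the form $K\exp\!\big(-\tfrac i4\sum_{k,l}G_{kl}\tilde c_k\tilde c_l\big)$, with $G$ real antisymmetric and $K$ a normalization constant, or a limit of such operators; the covariance matrix of a state $\rho$ is $\gamma_{kl}=-\tfrac1{2i}\mathrm{tr}(\rho[\tilde c_k,\tilde c_l])$. Let $\mathcal E$ be a Gaussian separable trace-preserving map on the $n$ modes, i.e. a completely positive trace-preserving linear map on the operators on Fock space whose Choi–Jamiołkowski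 state $\rho_{\mathcal E}=(\mathcal E\,\tilde\otimes\,\mathrm{id})(\Phi^+)$ on $2n$ modes, where $\Phi^+=2^{-2n}\prod_{a=1}^{2n}(1+i\tilde c_a\tilde c_{2n+a})$, is a Gaussian state with direct-sum covariance matrix $\Gamma=\bigoplus_{i=1}^n\Gamma_i$, where $\Gamma_i$ belongs to the modes $i$ and $n+i$. (If $\mathcal E$ has Kraus operators $A_j$, then $\mathcal E\,\tilde\otimes\,\mathrm{id}$ has as Kraus operators the same expressions $A_j$ in the Majorana operators of the first $n$ of the $2n$ modes.) Suppose that there are pure fermionic states $|\Psi\rangle$ and $|\Phi\rangle$ of the $n$ modes, with $|\Phi\rangle$ fully entangled, such that $\mathcal E(|\Psi\rangle\langle\Psi|)=|\Phi\rangle\langle\Phi|$. Then there are Gaussian local unitaries $U_1,\dots,U_n$ such that $$\mathcal E(\rho)=(U_1U_2\cdots U_n)\,\rho\,(U_1U_2\cdots U_n)^\dagger\qquad\text{for all }\rho .$$ Here a Gaussian local unitary on mode $i$ is a unitary $U_i$ that lies in the algebra generated by $\tilde c_{2i-1},\tilde c_{2i}$, commutes or anticommutes with $P$, and satisfies $U_i^\dagger\tilde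 c_{2i-2+a}U_i=\sum_{b=1}^2O_{ab}\tilde c_{2i-2+b}$ for $a=1,2$ and some real orthogonal $2\times2$ matrix $O$. -/

import Mathlib

open scoped Matrix ComplexOrder

namespace Fermion

/-- Occupation numbers of `N` modes; they index the Fock basis `|k₁,…,k_N⟩`. -/
abbrev Occ (N : ℕ) : Type := Fin N → Fin 2

/-- Operators on the Fock space of `N` modes, as matrices in the Fock basis. -/
abbrev Op (N : ℕ) : Type := Matrix (Occ N) (Occ N) ℂ

/-- The annihilation operator of mode `k`: it annihilates `|s⟩` if `s k = 0`, and otherwise sends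
`|s⟩` to `(-1) ^ (s₁ + ⋯ + s_{k-1}) |s - e_k⟩`. Here
`|k₁,…,k_N⟩ = (b₁†)^k₁ ⋯ (b_N†)^k_N |0⟩`. -/
def annih {N : ℕ} (k : Fin N) : Op N :=
  Matrix.of fun t s =>
    if s k = 1 ∧ t = Function.update s k 0 then (-1 : ℂ) ^ (∑ j ∈ Finset.Iio k, (s j : ℕ)) else 0

/-- The Majorana operators; `majorana (k, 0) = b_k + b_k†` and
`majorana (k, 1) = -i (b_k - b_k†)`. -/
noncomputable def majorana {N : ℕ} (p : Fin N × Fin 2) : Op N :=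
  if p.2 = 0 then annih p.1 + (annih p.1)ᴴ
  else (-Complex.I) • (annih p.1 - (annih p.1)ᴴ)

/-- The parity operator `(-1) ^ (n₁ + ⋯ + n_N)`. -/
def parity (N : ℕ) : Op N :=
  Matrix.diagonal fun s => (-1 : ℂ) ^ (∑ j, (s j : ℕ))

/-- The operators acting on the modes in `S`: the algebra generated by the Majorana operators of
these modes. -/
noncomputable def modeAlgebra {N : ℕ} (S : Finset (Fin N)) : Subalgebra ℂ (Op N) :=
  Algebra.adjoin ℂ {x | ∃ k ∈ S, ∃ a : Fin 2, x = majorana (k, a)}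

/-- The projector `|ψ⟩⟨ψ|`. -/
def proj {N : ℕ} (ψ : Occ N → ℂ) : Op N := Matrix.vecMulVec ψ (star ψ)

/-- Pure fermionic states: unit vectors whose projector respects the parity superselection rule. -/
structure IsPureState {N : ℕ} (ψ : Occ N → ℂ) : Prop where
  norm_eq_one : star ψ ⬝ᵥ ψ = 1
  fermionic : Commute (proj ψ) (parity N)

/-- `ρ` factorizes as `ρ_S ⊗̃ ρ_{Sᶜ}`, both factors being (possibly unnormalized) states that
commute with the parity operator. -/
def FactorizesAcross {N : ℕ} (S : Finset (Fin N)) (ρ : Op N) : Prop :=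
  ∃ A ∈ modeAlgebra S, ∃ B ∈ modeAlgebra Sᶜ,
    A.PosSemidef ∧ B.PosSemidef ∧ Commute A (parity N) ∧ Commute B (parity N) ∧ ρ = A * B

/-- No nonempty proper subset of the modes factorizes from the remaining modes. -/
def FullyEntangled {N : ℕ} (ψ : Occ N → ℂ) : Prop :=
  ∀ S : Finset (Fin N), S.Nonempty → Sᶜ.Nonempty → ¬ FactorizesAcross S (proj ψ)

/-- The quadratic Hamiltonian `(i/4) ∑ G_pq c_p c_q`. -/
noncomputable def quadHam {N : ℕ} (G : Matrix (Fin N × Fin 2) (Fin N × Fin 2) ℝ) : Op N :=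
  (Complex.I / 4) • ∑ p, ∑ q, (G p q : ℂ) • (majorana p * majorana q)

/-- Gibbs states `K exp (-(i/4) cᵀ G c)` of quadratic Hamiltonians, `G` real antisymmetric and `K`
the normalization constant. -/
def gibbsStates (N : ℕ) : Set (Op N) :=
  {ρ | ∃ G : Matrix (Fin N × Fin 2) (Fin N × Fin 2) ℝ, Gᵀ = -G ∧
    ρ = (NormedSpace.exp (-quadHam G)).trace⁻¹ • NormedSpace.exp (-quadHam G)}

/-- Gaussian fermionic states: Gibbs states of quadratic Hamiltonians and limits of these. -/
def IsGaussianState {N : ℕ} (ρ : Op N) : Prop := ρ ∈ closure (gibbsStates N)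

/-- The covariance matrix, `γ_pq = -1/(2i) tr (ρ [c_p, c_q])`. -/
noncomputable def covariance {N : ℕ} (ρ : Op N) : Matrix (Fin N × Fin 2) (Fin N × Fin 2) ℂ :=
  Matrix.of fun p q =>
    -(1 / (2 * Complex.I)) * (ρ * (majorana p * majorana q - majorana q * majorana p)).trace

/-- `E ⊗ id` on the operators on (Fock space) ⊗ ℂ^κ; if `E X = ∑ A_j X A_jᴴ`, then this is the map
with Kraus operators `A_j ⊗ 1`. -/
def ampliation {N : ℕ} (E : Op N →ₗ[ℂ] Op N) {κ : Type*}
    (M : Matrix (Occ N × κ) (Occ N × κ) ℂ) : Matrix (Occ N × κ) (Occ N × κ) ℂ :=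
  Matrix.of fun x y => E (Matrix.of fun s t => M (s, x.2) (t, y.2)) x.1 y.1

/-- Complete positivity. -/
def IsCompletelyPositive {N : ℕ} (E : Op N →ₗ[ℂ] Op N) : Prop :=
  ∀ (m : ℕ) (M : Matrix (Occ N × Fin m) (Occ N × Fin m) ℂ),
    M.PosSemidef → (ampliation E M).PosSemidef

/-- The maximally entangled state of modes `1,…,n` with modes `n+1,…,2n` (as a density operator):
the normalized product of the operators `1 + i c_a c_{2n+a}` over the `2n` Majorana operators `c_a`
of the first `n` modes. These factors commute. -/
noncomputable def maxEntangled (n : ℕ) : Op (n + n) :=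
  ((4 : ℂ) ^ n)⁻¹ • (List.ofFn fun k : Fin n =>
    (1 + Complex.I • (majorana (Fin.castAdd n k, 0) * majorana (Fin.natAdd n k, 0))) *
    (1 + Complex.I • (majorana (Fin.castAdd n k, 1) * majorana (Fin.natAdd n k, 1)))).prod

/-- The Choi–Jamiołkowski state `(E ⊗̃ id) (Φ⁺)`. In the Fock basis an operator acting on the first
`n` of `2n` modes is of the form `A ⊗ 1`, so that `E ⊗̃ id` is the ampliation of `E`. -/
noncomputable def choiState {n : ℕ} (E : Op n →ₗ[ℂ] Op n) : Op (n + n) :=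
  Matrix.reindex (Fin.appendEquiv n n) (Fin.appendEquiv n n)
    (ampliation E (Matrix.reindex (Fin.appendEquiv n n).symm (Fin.appendEquiv n n).symm
      (maxEntangled n)))

/-- The party holding a mode of the Choi–Jamiołkowski state: party `i` holds the modes `i`
and `n + i`. -/
def party {n : ℕ} (k : Fin (n + n)) : Fin n := Fin.addCases id id k

/-- Gaussian separable trace-preserving maps on `n` spatially separated modes: the
Choi–Jamiołkowski state is Gaussian and its covariance matrix is the direct sum of blocks
`Γ_i`, one for each party. -/
structure IsGaussianSeparable {n : ℕ} (E : Op n →ₗ[ℂ] Op n) : Prop where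
  completelyPositive : IsCompletelyPositive E
  tracePreserving : ∀ X, (E X).trace = X.trace
  gaussian : IsGaussianState (choiState E)
  directSum : ∀ p q : Fin (n + n) × Fin 2, party p.1 ≠ party q.1 →
    covariance (choiState E) p q = 0

/-- Gaussian local unitaries on mode `i`: unitaries of definite parity acting on mode `i` only and
transforming its Majorana operators by a real orthogonal matrix. -/
structure IsLocalUnitary {n : ℕ} (i : Fin n) (U : Op n) : Prop where
  unitary : U ∈ Matrix.unitaryGroup (Occ n) ℂ
  loc : U ∈ modeAlgebra {i}
  definiteParity : U * parity n = parity n * U ∨ U * parity n = -(parity n * U)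
  canonical : ∃ O ∈ Matrix.orthogonalGroup (Fin 2) ℝ, ∀ a,
    Uᴴ * majorana (i, a) * U = ∑ b, (O a b : ℂ) • majorana (i, b)

end Fermion

open scoped Kronecker

namespace Fermion

/-! ### Jordan–Wigner form of the Majorana operators and their anticommutation relations -/

section

variable {N : ℕ}

/-! A Gaussian state satisfies Wick's theorem in operator form: each commutator [ρ, c_p] is a
combination of anticommutators {ρ, c_q}, with coefficients read off from the covariance matrix
(`IsGaussianState.wickRelation`). For the Choi state the direct-sum hypothesis keeps these relations
within one party, and trace preservation kills the input-input block. Multiplying the Choi operator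
by an output Majorana operator multiplies the values of `E`; multiplying it by an input one
multiplies the argument, up to parity factors, because input operators can be moved across the
maximally entangled state. As the Choi operator determines the map (`choi_injective`), the relations
become identities for `E`.

Let α be the output-output and β the output-input block of `kappa`. Elimination leaves an identity
whose left side is (1 + α + ββᵀ) applied to c·E(X) and whose right side has only right
multiplications of E(X) or of X. At X = |Ψ⟩⟨Ψ| positivity confines the range of the right side to
the line of Φ (`proj_mul_map_vecMulVec`). A nonzero row of 1 + α + ββᵀ would thus make Φ an
eigenvector of a Majorana combination of a single mode, and that mode would factor out
(`factorizesAcross_of_eigenvector`), contrary to full entanglement. So 1 + α + ββᵀ = 0, which with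
the antisymmetry of α gives α = 0 and β = -iB with B real orthogonal.

The relations now say that `E` intertwines the operators P c_p with their rotated versions, on both
sides. A local unitary implements each rotation. Undoing the product of these unitaries leaves a
trace-preserving map that commutes with left and right multiplication by a generating set, and such
a map is the identity. -/

/-- The weighted translation `|s⟩ ↦ f s |s + v⟩` of the Fock basis. -/
def mono (f : Occ N → ℂ) (v : Occ N) : Op N :=
  Matrix.of fun t s => if t = s + v then f s else 0

/-- The parity `(-1) ^ (∑ j ∈ T, s j)` of the occupation of `T`. -/
def sgn (T : Finset (Fin N)) (s : Occ N) : ℂ := ∏ j ∈ T, (-1 : ℂ) ^ (s j : ℕ)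

lemma mono_mul (f g : Occ N → ℂ) (v w : Occ N) :
    mono f v * mono g w = mono (fun s => f (s + w) * g s) (v + w) := by
  ext t s
  simp only [mono, Matrix.mul_apply, Matrix.of_apply, mul_ite, mul_zero]
  rw [Finset.sum_ite_eq' Finset.univ (s + w)]
  simp [add_assoc, add_comm w v, ite_mul]

lemma mono_add (f g : Occ N → ℂ) (v : Occ N) : mono f v + mono g v = mono (f + g) v := by
  ext t s
  simp only [mono, Matrix.add_apply, Matrix.of_apply, Pi.add_apply]
  split_ifs <;> simp

lemma mono_smul (a : ℂ) (f : Occ N → ℂ) (v : Occ N) : a • mono f v = mono (fun s => a * f s) v := by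
  ext t s
  simp [mono]

lemma mono_zero_right (f : Occ N → ℂ) : mono f 0 = Matrix.diagonal f := by
  ext t s
  by_cases h : t = s <;> simp [mono, h]

lemma mono_zero_left (v : Occ N) : mono 0 v = 0 := by
  ext t s
  simp [mono]

lemma neg_one_pow_add_one (x : Fin 2) : (-1 : ℂ) ^ ((x + 1 : Fin 2) : ℕ) = -(-1) ^ (x : ℕ) := by
  fin_cases x <;> simp

lemma single_add_single (k : Fin N) : (Pi.single k 1 + Pi.single k 1 : Occ N) = 0 := by
  rw [← Pi.single_add]
  exact Pi.single_zero k

/-- All signs between Majorana operators come from this rule: with `mono_mul` it reduces each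
(anti)commutation to whether a mode lies in the other's string. -/
lemma sgn_add_single (T : Finset (Fin N)) (s : Occ N) (l : Fin N) :
    sgn T (s + Pi.single l 1) = (if l ∈ T then -1 else 1) * sgn T s := by
  have h : ∀ j, (-1 : ℂ) ^ ((s + Pi.single l 1 : Occ N) j : ℕ) =
      (if j = l then -1 else 1) * (-1) ^ (s j : ℕ) := by
    intro j
    by_cases hj : j = l
    · subst hj
      rw [Pi.add_apply, Pi.single_eq_same, neg_one_pow_add_one]; simp
    · simp [hj]
  simp only [sgn, h, Finset.prod_mul_distrib, Finset.prod_ite_eq']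

lemma sgn_mul_self (T : Finset (Fin N)) (s : Occ N) : sgn T s * sgn T s = 1 := by
  rw [sgn, ← Finset.prod_mul_distrib]
  apply Finset.prod_eq_one
  intro j _
  rw [← mul_pow]; simp

lemma sgn_ne_zero (T : Finset (Fin N)) (s : Occ N) : sgn T s ≠ 0 :=
  left_ne_zero_of_mul_eq_one (sgn_mul_self T s)

lemma star_sgn (T : Finset (Fin N)) (s : Occ N) : star (sgn T s) = sgn T s := by
  simp [sgn, star_prod]

lemma sgn_Iic (k : Fin N) (s : Occ N) : sgn (Finset.Iic k) s = (-1) ^ (s k : ℕ) * sgn (Finset.Iio k) s := by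
  rw [sgn, ← Finset.Iio_insert, Finset.prod_insert (by simp), sgn]

lemma parity_eq_mono : parity N = mono (sgn Finset.univ) 0 := by
  rw [mono_zero_right, parity]
  congr 1; ext s
  rw [sgn, Finset.prod_pow_eq_pow_sum]

lemma annih_eq_mono (k : Fin N) :
    annih k = mono (fun s => if s k = 1 then sgn (Finset.Iio k) s else 0) (Pi.single k 1) := by
  ext t s
  have h : s k = 1 → Function.update s k 0 = s + Pi.single k 1 := by
    intro hk
    ext j
    by_cases hj : j = k
    · subst hj; simp [hk]
    · simp [hj]
  by_cases hk : s k = 1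
  · simp [annih, mono, hk, h hk, sgn, Finset.prod_pow_eq_pow_sum]
  · simp [annih, mono, hk]

lemma mono_conjTranspose (f : Occ N → ℂ) (k : Fin N) :
    (mono f (Pi.single k 1))ᴴ =
      mono (fun s => star (f (s + Pi.single k 1))) (Pi.single k 1) := by
  ext t s
  have h : s = t + Pi.single k 1 ↔ t = s + Pi.single k 1 := by
    constructor <;> rintro rfl <;> rw [add_assoc, single_add_single, add_zero]
  simp only [mono, Matrix.conjTranspose_apply, Matrix.of_apply, h]
  split_ifs with h1
  · subst h1; rfl
  · simp

lemma annih_conjTranspose (k : Fin N) :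
    (annih k)ᴴ = mono (fun s => if s k = 1 then 0 else sgn (Finset.Iio k) s) (Pi.single k 1) := by
  rw [annih_eq_mono, mono_conjTranspose]
  congr 1; ext s
  have : (s k + 1 = 1) ↔ ¬ s k = 1 := by generalize s k = x; fin_cases x <;> simp
  simp only [Pi.add_apply, Pi.single_eq_same, this, sgn_add_single]
  split_ifs <;> simp_all [star_sgn]

lemma majorana_zero_eq (k : Fin N) :
    majorana (k, 0) = mono (sgn (Finset.Iio k)) (Pi.single k 1) := by
  simp only [majorana, if_true, annih_conjTranspose]
  rw [annih_eq_mono, mono_add]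
  congr 1; ext s
  by_cases h : s k = 1 <;> simp [h]

/-- The relative minus between b_k and b_k† is the number sign of mode `k`; absorbing it extends the
string from `Iio k` to `Iic k`. -/
lemma majorana_one_eq (k : Fin N) :
    majorana (k, 1) = mono (fun s => Complex.I * sgn (Finset.Iic k) s) (Pi.single k 1) := by
  simp only [majorana, annih_conjTranspose, one_ne_zero, if_false]
  rw [annih_eq_mono, sub_eq_add_neg, ← neg_one_smul ℂ (mono _ _), mono_smul, mono_add, mono_smul]
  congr 1; ext s
  rw [sgn_Iic]
  have : s k = 0 ∨ s k = 1 := by generalize s k = x; fin_cases x <;> simp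
  rcases this with h | h <;> simp [h]

lemma majorana_sq (p : Fin N × Fin 2) : majorana p * majorana p = 1 := by
  obtain ⟨k, a⟩ := p
  rw [← Matrix.diagonal_one, ← mono_zero_right]
  fin_cases a
  · simp only [Fin.zero_eta, majorana_zero_eq, mono_mul, single_add_single, sgn_add_single]
    congr 1; ext s; simp [sgn_mul_self]
  · simp only [Fin.mk_one, majorana_one_eq, mono_mul, single_add_single, sgn_add_single]
    congr 1; ext s
    simp only [Finset.mem_Iic, le_refl, if_true]
    linear_combination (-Complex.I * Complex.I) * sgn_mul_self (Finset.Iic k) s - Complex.I_mul_I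

lemma majorana_anticomm_of_lt {k l : Fin N} (h : k < l) (a b : Fin 2) :
    majorana (k, a) * majorana (l, b) + majorana (l, b) * majorana (k, a) = 0 := by
  have h1 : ¬ l < k := h.asymm
  have h2 : ¬ l ≤ k := not_le.mpr h
  have h3 : k ≤ l := h.le
  fin_cases a <;> fin_cases b <;>
    simp only [Fin.zero_eta, Fin.mk_one, majorana_zero_eq, majorana_one_eq, mono_mul,
      add_comm (Pi.single l 1 : Occ N), mono_add, sgn_add_single] <;>
    rw [← mono_zero_left] <;> congr 1 <;> ext s <;>
    simp only [Finset.mem_Iio, Finset.mem_Iic, h, h1, h2, h3, if_true, if_false, Pi.add_apply,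
      Pi.zero_apply] <;> ring

lemma majorana_anticomm {p q : Fin N × Fin 2} (h : p ≠ q) :
    majorana p * majorana q = -(majorana q * majorana p) := by
  rw [← add_eq_zero_iff_eq_neg]
  obtain ⟨k, a⟩ := p
  obtain ⟨l, b⟩ := q
  rcases lt_trichotomy k l with hkl | hkl | hkl
  · exact majorana_anticomm_of_lt hkl a b
  · subst hkl
    have key : majorana (k, 0) * majorana (k, 1) + majorana (k, 1) * majorana (k, 0) = 0 := by
      simp only [majorana_zero_eq, majorana_one_eq, mono_mul, mono_add, sgn_add_single]
      rw [← mono_zero_left]; congr 1; ext s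
      simp; ring
    fin_cases a <;> fin_cases b
    · simp at h
    · exact key
    · rw [add_comm]; exact key
    · simp at h
  · rw [add_comm]; exact majorana_anticomm_of_lt hkl b a

lemma majorana_mul_add (p q : Fin N × Fin 2) :
    majorana p * majorana q + majorana q * majorana p = if p = q then (2 : ℂ) • 1 else 0 := by
  split_ifs with h
  · subst h; rw [majorana_sq, two_smul]
  · rw [majorana_anticomm h]; simp

lemma majorana_conjTranspose (p : Fin N × Fin 2) : (majorana p)ᴴ = majorana p := by
  unfold majorana
  split_ifs
  · rw [Matrix.conjTranspose_add, Matrix.conjTranspose_conjTranspose, add_comm]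
  · rw [Matrix.conjTranspose_smul, Matrix.conjTranspose_sub, Matrix.conjTranspose_conjTranspose]
    simp only [star_neg, RCLike.star_def, Complex.conj_I, neg_neg, neg_smul, smul_sub]; abel

lemma parity_sq : parity N * parity N = 1 := by
  rw [parity_eq_mono, mono_mul, ← Matrix.diagonal_one, ← mono_zero_right]
  simp [sgn_mul_self]

lemma parity_mul_majorana (p : Fin N × Fin 2) :
    parity N * majorana p = -(majorana p * parity N) := by
  obtain ⟨k, a⟩ := p
  rw [← add_eq_zero_iff_eq_neg, parity_eq_mono]
  fin_cases a <;>
    simp only [Fin.zero_eta, Fin.mk_one, majorana_zero_eq, majorana_one_eq, mono_mul,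
      zero_add, add_zero, mono_add, sgn_add_single] <;>
    rw [← mono_zero_left] <;> congr 1 <;> ext s <;> simp <;> ring

lemma parity_conj_majorana (p : Fin N × Fin 2) :
    parity N * majorana p * parity N = -majorana p := by
  rw [parity_mul_majorana, neg_mul, mul_assoc, parity_sq, mul_one]

end

/-! ### Conjugation of Majorana operators by exponentials of quadratic Hamiltonians -/

section

variable {N : ℕ}

section ExpConj
variable {A : Type*} [NormedRing A] [NormedAlgebra ℂ A] [CompleteSpace A]

/-- If a closed subspace is invariant under the commutator with `a`, then it is invariant under
conjugation with `exp a`. -/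
lemma exp_conj_mem {V : Submodule ℂ A} (hV : IsClosed (V : Set A)) {a : A}
    (ha : ∀ x ∈ V, a * x - x * a ∈ V) {x : A} (hx : x ∈ V) :
    NormedSpace.exp a * x * NormedSpace.exp (-a) ∈ V := by
  -- Left multiplication by `a` and right multiplication by `-a` commute, so conjugation by `exp a`
  -- is `exp (l + r)`, and `l + r` is the commutator with `a`. The partial sums of its series
  -- preserve `V`, and `V` is closed.
  let l : A →L[ℂ] A := ContinuousLinearMap.mul ℂ A a
  let r : A →L[ℂ] A := (ContinuousLinearMap.mul ℂ A).flip (-a)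
  have hl : ∀ n y, (l ^ n) y = a ^ n * y := by
    intro n y
    induction n generalizing y with
    | zero => simp
    | succ n ih => rw [pow_succ, mul_apply_eq_comp, ih]; simp [l, pow_succ, mul_assoc]
  have hr : ∀ n y, (r ^ n) y = y * (-a) ^ n := by
    intro n y
    induction n generalizing y with
    | zero => simp
    | succ n ih =>
      rw [pow_succ, mul_apply_eq_comp, ih, pow_succ']; simp [r, mul_assoc]
  have hcomm : Commute l r := by
    ext y
    simp [l, r, mul_assoc]
  have key : ∀ f : A →L[ℂ] A, ∀ y, HasSum (fun n : ℕ => ((n.factorial : ℂ)⁻¹) • (f ^ n) y)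
      (NormedSpace.exp f y) := by
    intro f y
    have := NormedSpace.exp_series_hasSum_exp' (𝕂 := ℂ) f
    exact this.mapL (ContinuousLinearMap.apply ℂ A y)
  have el : ∀ y, NormedSpace.exp l y = NormedSpace.exp a * y := by
    intro y
    have h1 := key l y
    have h2 := (NormedSpace.exp_series_hasSum_exp' (𝕂 := ℂ) a).mul_right y
    refine h1.unique ?_
    simpa [hl] using h2
  have er : ∀ y, NormedSpace.exp r y = y * NormedSpace.exp (-a) := by
    intro y
    have h1 := key r y
    have h2 := (NormedSpace.exp_series_hasSum_exp' (𝕂 := ℂ) (-a)).mul_left y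
    refine h1.unique ?_
    simpa [hr] using h2
  have e : NormedSpace.exp a * x * NormedSpace.exp (-a) = NormedSpace.exp (l + r) x := by
    let _ := NormedAlgebra.restrictScalars ℚ ℂ (A →L[ℂ] A)
    rw [NormedSpace.exp_add_of_commute hcomm, mul_apply_eq_comp, el, er, mul_assoc]
  rw [e]
  have hn : ∀ n : ℕ, ((l + r) ^ n) x ∈ V := by
    intro n
    induction n with
    | zero => simpa
    | succ n ih =>
      rw [pow_succ', mul_apply_eq_comp]
      have := ha _ ih
      simpa [l, r, sub_eq_add_neg] using this
  exact hV.mem_of_tendsto (key (l + r) x)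
    (Filter.Eventually.of_forall fun s => V.sum_mem fun n _ => V.smul_mem _ (hn n))

end ExpConj

/-- Complex linear combinations of Majorana operators. -/
noncomputable def lin (x : Fin N × Fin 2 → ℂ) : Op N := ∑ p, x p • majorana p

lemma mem_span_iff {X : Op N} :
    X ∈ Submodule.span ℂ (Set.range (majorana (N := N))) ↔ ∃ x, X = lin x := by
  rw [Submodule.mem_span_range_iff_exists_fun]
  simp only [lin, eq_comm]

/-- Two anticommutations leave only linear terms, so commutators with a quadratic Hamiltonian
preserve the span of the Majorana operators. -/
lemma mul_mul_majorana_sub (p q r : Fin N × Fin 2) :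
    majorana p * majorana q * majorana r - majorana r * (majorana p * majorana q) =
      (if q = r then (2 : ℂ) else 0) • majorana p - (if p = r then (2 : ℂ) else 0) • majorana q := by
  have h1 := majorana_mul_add q r
  have h2 := majorana_mul_add p r
  have : majorana p * majorana q * majorana r - majorana r * (majorana p * majorana q) =
      majorana p * (majorana q * majorana r + majorana r * majorana q) -
        (majorana p * majorana r + majorana r * majorana p) * majorana q := by noncomm_ring
  rw [this, h1, h2]
  split_ifs <;> simp

lemma quadHam_comm_mem {G : Matrix (Fin N × Fin 2) (Fin N × Fin 2) ℝ} {X : Op N}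
    (hX : X ∈ Submodule.span ℂ (Set.range (majorana (N := N)))) :
    -quadHam G * X - X * -quadHam G ∈ Submodule.span ℂ (Set.range (majorana (N := N))) := by
  induction hX using Submodule.span_induction with
  | mem x h =>
    obtain ⟨r, rfl⟩ := h
    have : -quadHam G * majorana r - majorana r * -quadHam G =
        -((Complex.I / 4) • ∑ p, ∑ q, (G p q : ℂ) •
          (majorana p * majorana q * majorana r - majorana r * (majorana p * majorana q))) := by
      simp only [quadHam, neg_mul, mul_neg, smul_mul_assoc, mul_smul_comm, Finset.sum_mul,
        Finset.mul_sum, smul_sub, Finset.sum_sub_distrib]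
      abel
    rw [this]
    simp only [mul_mul_majorana_sub]
    refine Submodule.neg_mem _ (Submodule.smul_mem _ _ (Submodule.sum_mem _ fun p _ =>
      Submodule.sum_mem _ fun q _ => Submodule.smul_mem _ _ (Submodule.sub_mem _ ?_ ?_))) <;>
    exact Submodule.smul_mem _ _ (Submodule.subset_span ⟨_, rfl⟩)
  | zero => simp
  | add x y _ _ hx hy => convert Submodule.add_mem _ hx hy using 1; noncomm_ring
  | smul a x _ hx =>
    convert Submodule.smul_mem _ a hx using 1
    simp

lemma exp_quadHam_conj (G : Matrix (Fin N × Fin 2) (Fin N × Fin 2) ℝ) (p : Fin N × Fin 2) :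
    ∃ x, NormedSpace.exp (-quadHam G) * majorana p = lin x * NormedSpace.exp (-quadHam G) := by
  have h : NormedSpace.exp (-quadHam G) * majorana p * NormedSpace.exp (- -quadHam G) ∈
      Submodule.span ℂ (Set.range (majorana (N := N))) := by
    open scoped Matrix.Norms.Operator in
    exact exp_conj_mem (A := Op N)
      (V := Submodule.span ℂ (Set.range (majorana (N := N))))
      (Submodule.closed_of_finiteDimensional _)
      (a := -quadHam G) (fun x hx => quadHam_comm_mem hx) (Submodule.subset_span ⟨p, rfl⟩)
  obtain ⟨x, hx⟩ := mem_span_iff.mp h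
  refine ⟨x, ?_⟩
  rw [← hx, mul_assoc, ← Matrix.exp_add_of_commute _ _ ((Commute.refl (-quadHam G)).neg_left)]
  simp

lemma quadHam_isHermitian {G : Matrix (Fin N × Fin 2) (Fin N × Fin 2) ℝ} (hG : Gᵀ = -G) :
    (quadHam G).IsHermitian := by
  have hG' : ∀ p q, G q p = -G p q := fun p q => congrFun (congrFun hG p) q
  rw [Matrix.IsHermitian, quadHam, Matrix.conjTranspose_smul]
  simp only [Matrix.conjTranspose_sum, Matrix.conjTranspose_smul, Matrix.conjTranspose_mul,
    majorana_conjTranspose]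
  rw [Finset.sum_comm]
  simp only [Finset.smul_sum, smul_smul]
  refine Finset.sum_congr rfl fun p _ => Finset.sum_congr rfl fun q _ => ?_
  rw [hG' p q]
  congr 1
  simp
  ring

lemma posDef_exp {A : Op N} (hA : A.IsHermitian) : (NormedSpace.exp A).PosDef := by
  have h1 : NormedSpace.exp A =
      (NormedSpace.exp ((2⁻¹ : ℂ) • A))ᴴ * NormedSpace.exp ((2⁻¹ : ℂ) • A) := by
    rw [← Matrix.exp_conjTranspose, ← Matrix.exp_add_of_commute]
    · congr 1
      rw [Matrix.conjTranspose_smul, hA.eq, ← add_smul]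
      norm_num
    · rw [Matrix.conjTranspose_smul, hA.eq]
      exact ((Commute.refl A).smul_left _).smul_right _
  rw [h1]
  exact Matrix.PosDef.conjTranspose_mul_self _
    (Matrix.mulVec_injective_of_isUnit (Matrix.isUnit_exp _))

end

/-! ### Wick's theorem in operator form for Gaussian states -/

section

variable {N : ℕ}

lemma lin_add (x y : Fin N × Fin 2 → ℂ) : lin (x + y) = lin x + lin y := by
  simp [lin, add_smul, Finset.sum_add_distrib]

lemma lin_sub (x y : Fin N × Fin 2 → ℂ) : lin (x - y) = lin x - lin y := by
  simp [lin, sub_smul, Finset.sum_sub_distrib]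

lemma lin_vecMul (x : Fin N × Fin 2 → ℂ) (T : Matrix (Fin N × Fin 2) (Fin N × Fin 2) ℂ) :
    lin (x ᵥ* T) = ∑ p, x p • lin (T p) := by
  simp only [lin, Matrix.vecMul, dotProduct, Finset.sum_smul, Finset.smul_sum, smul_smul]
  exact Finset.sum_comm

lemma lin_single (p : Fin N × Fin 2) : lin (Pi.single p 1) = majorana p := by
  simp [lin, Pi.single_apply]

lemma lin_mul_majorana_add (x : Fin N × Fin 2 → ℂ) (p : Fin N × Fin 2) :
    lin x * majorana p + majorana p * lin x = (2 * x p) • 1 := by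
  simp only [lin, Finset.sum_mul, Finset.mul_sum, smul_mul_assoc, mul_smul_comm]
  rw [← Finset.sum_add_distrib]
  simp only [← smul_add, majorana_mul_add, smul_ite, smul_zero, Finset.sum_ite_eq',
    Finset.mem_univ, if_true, smul_smul, mul_comm]

lemma eq_zero_of_lin_eq_zero {x : Fin N × Fin 2 → ℂ} (h : lin x = 0) : x = 0 := by
  ext p
  have := lin_mul_majorana_add x p
  rw [h, zero_mul, mul_zero, add_zero] at this
  have h2 := congrFun (congrFun this 0) 0
  simpa using h2.symm

/-- Half the expectation values of the commutators of Majorana operators. -/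
noncomputable def kappa (ρ : Op N) : Matrix (Fin N × Fin 2) (Fin N × Fin 2) ℂ :=
  Matrix.of fun p q =>
    2⁻¹ * (ρ * (majorana p * majorana q - majorana q * majorana p)).trace

/-- Wick's theorem in operator form, together with normalization and hermiticity. -/
structure WickRelation (ρ : Op N) : Prop where
  trace_eq_one : ρ.trace = 1
  isHermitian : ρᴴ = ρ
  comm : ∀ p, ρ * majorana p - majorana p * ρ =
    ∑ q, kappa ρ p q • (ρ * majorana q + majorana q * ρ)

lemma eq_zero_of_conj_trace_eq_zero {A B : Op N} (hA : A.PosDef)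
    (h : (B * A * Bᴴ).trace = 0) : B = 0 := by
  have h0 : B * A * Bᴴ = 0 := (hA.posSemidef.mul_mul_conjTranspose_same B).trace_eq_zero_iff.mp h
  have h1 : Bᴴ = 0 := by
    apply Matrix.ext_of_mulVec_single
    intro i
    by_contra hne
    rw [Matrix.zero_mulVec] at hne
    have := hA.dotProduct_mulVec_pos hne
    rw [Matrix.star_mulVec, Matrix.conjTranspose_conjTranspose, Matrix.mulVec_mulVec,
      ← Matrix.dotProduct_mulVec, Matrix.mulVec_mulVec, ← mul_assoc, h0] at this
    simp at this
  simpa using congrArg Matrix.conjTranspose h1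

/-- If y T = -y, then `A` anticommutes with Y = `lin y`. The traces of Y†AY and YAY† then cancel;
both are nonnegative, so both vanish and positive definiteness gives Y = 0. Invertibility of 1 + T
is what allows commutators to be expressed through anticommutators. -/
lemma isUnit_one_add_of_intertwine {A : Op N} (hA : A.PosDef)
    {T : Matrix (Fin N × Fin 2) (Fin N × Fin 2) ℂ}
    (hT : ∀ p, A * majorana p = lin (T p) * A) : IsUnit (1 + T) := by
  rw [← Matrix.vecMul_injective_iff_isUnit]
  have key : ∀ y, y ᵥ* (1 + T) = 0 → y = 0 := by
    intro y hy
    have h1 : A * lin y = lin (y ᵥ* T) * A := by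
      rw [lin_vecMul]
      simp only [Finset.sum_mul, smul_mul_assoc, ← hT]
      simp only [lin, Finset.mul_sum, mul_smul_comm]
    have h2 : y ᵥ* T = -y := by
      rw [Matrix.vecMul_add, Matrix.vecMul_one] at hy
      exact (neg_eq_of_add_eq_zero_right hy).symm
    have h3 : lin (-y) = - lin y := by simp [lin]
    rw [h2, h3] at h1
    have h4 : ((lin y)ᴴ * A * lin y).trace + (lin y * A * (lin y)ᴴ).trace = 0 := by
      rw [mul_assoc, h1, Matrix.trace_mul_comm (lin y * A), ← Matrix.trace_add, ← mul_add]
      simp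
    have h5 := (hA.posSemidef.conjTranspose_mul_mul_same (lin y)).trace_nonneg
    have h6 := (hA.posSemidef.mul_mul_conjTranspose_same (lin y)).trace_nonneg
    have h7 : (lin y * A * (lin y)ᴴ).trace = 0 :=
      le_antisymm (by rw [← h4]; exact le_add_of_nonneg_left h5) h6
    exact eq_zero_of_lin_eq_zero (eq_zero_of_conj_trace_eq_zero hA h7)
  intro x y hxy
  rw [← sub_eq_zero]
  apply key
  rw [Matrix.sub_vecMul, sub_eq_zero]
  exact hxy

lemma trace_mul_comm_majorana (ρ : Op N) (p r : Fin N × Fin 2) :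
    ((ρ * majorana p - majorana p * ρ) * majorana r).trace = 2 * kappa ρ p r := by
  simp only [kappa, Matrix.of_apply, sub_mul, mul_sub, Matrix.trace_sub]
  rw [mul_assoc (majorana p), Matrix.trace_mul_comm (majorana p), mul_assoc, mul_assoc]
  ring

/-- Tracing against `majorana r` turns the anticommutators into 2δ and the commutator into 2κ, so
the coefficients depend on `ρ` alone and no longer on the Hamiltonian. -/
lemma eq_kappa {ρ : Op N} (h1 : ρ.trace = 1) {W : Matrix (Fin N × Fin 2) (Fin N × Fin 2) ℂ}
    (h : ∀ p, ρ * majorana p - majorana p * ρ =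
      ∑ q, W p q • (ρ * majorana q + majorana q * ρ)) : W = kappa ρ := by
  ext p r
  have h2 := trace_mul_comm_majorana ρ p r
  have h3 : ∀ q, ((ρ * majorana q + majorana q * ρ) * majorana r).trace =
      if q = r then 2 else 0 := by
    intro q
    rw [add_mul, Matrix.trace_add, mul_assoc (majorana q), Matrix.trace_mul_comm (majorana q),
      mul_assoc, mul_assoc, ← Matrix.trace_add, ← mul_add, majorana_mul_add]
    split_ifs <;> simp [h1]
  rw [h] at h2
  simp only [Finset.sum_mul, smul_mul_assoc, Matrix.trace_sum, Matrix.trace_smul, h3, smul_eq_mul,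
    mul_ite, mul_zero, Finset.sum_ite_eq', Finset.mem_univ, if_true] at h2
  linear_combination h2 / 2

/-- With ρ c = (T c) ρ, commutators and anticommutators are T - 1 and T + 1 applied to c, times ρ.
The coefficient matrix is the Cayley transform (T - 1)(T + 1)⁻¹. -/
lemma wickRelation_of_mem_gibbsStates {ρ : Op N} (h : ρ ∈ gibbsStates N) : WickRelation ρ := by
  obtain ⟨G, hG, hρ⟩ := h
  have hA : (NormedSpace.exp (-quadHam G)).PosDef := posDef_exp (quadHam_isHermitian hG).neg
  obtain ⟨T, hT⟩ : ∃ T : Matrix (Fin N × Fin 2) (Fin N × Fin 2) ℂ, ∀ p,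
      NormedSpace.exp (-quadHam G) * majorana p = lin (T p) * NormedSpace.exp (-quadHam G) :=
    Classical.axiom_of_choice (exp_quadHam_conj G)
  obtain ⟨R, hR⟩ := (isUnit_one_add_of_intertwine hA hT).exists_left_inv
  set A := NormedSpace.exp (-quadHam G)
  have htr : A.trace ≠ 0 := hA.trace_pos.ne'
  have h1 : ρ.trace = 1 := by
    rw [hρ, Matrix.trace_smul, smul_eq_mul, inv_mul_cancel₀ htr]
  have hstar : star A.trace = A.trace := by
    rw [← Matrix.trace_conjTranspose, hA.isHermitian.eq]
  have hT' : ∀ p, ρ * majorana p = lin (T p) * ρ := by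
    intro p
    rw [hρ, smul_mul_assoc, hT, mul_smul_comm]
  have hcomm : ∀ p, ρ * majorana p - majorana p * ρ = ∑ q, ((T - 1) * R) p q •
      (ρ * majorana q + majorana q * ρ) := by
    intro p
    have e1 : ∀ q, ρ * majorana q + majorana q * ρ = lin ((1 + T) q) * ρ := by
      intro q
      rw [hT', ← lin_single q, ← add_mul, ← lin_add, add_comm]
      congr 2
      ext r
      simp [Matrix.one_apply, Pi.single_apply, eq_comm]
    have e2 : ρ * majorana p - majorana p * ρ = lin ((T - 1) p) * ρ := by
      rw [hT', ← lin_single p, ← sub_mul, ← lin_sub]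
      congr 2
      ext r
      simp [Matrix.one_apply, Pi.single_apply, eq_comm]
    simp only [e1, e2, ← smul_mul_assoc, ← Finset.sum_mul]
    rw [← lin_vecMul]
    congr 2
    have : ((T - 1) * R * (1 + T)) p = (T - 1) p := by
      rw [mul_assoc, hR, mul_one]
    rw [← this]
    rfl
  refine ⟨h1, ?_, ?_⟩
  · rw [hρ, Matrix.conjTranspose_smul, hA.isHermitian.eq, star_inv₀, hstar]
  · rw [← eq_kappa h1 hcomm]
    exact hcomm

/-- The Hamiltonians may diverge along a limit of Gibbs states, but the coefficients `kappa ρ` are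
continuous in `ρ`, so the relation is a closed condition. -/
lemma IsGaussianState.wickRelation {ρ : Op N} (h : IsGaussianState ρ) : WickRelation ρ := by
  have hsub : gibbsStates N ⊆ {ρ | WickRelation ρ} := fun ρ h => wickRelation_of_mem_gibbsStates h
  have hcl : IsClosed {ρ : Op N | WickRelation ρ} := by
    have : {ρ : Op N | WickRelation ρ} = {ρ | ρ.trace = 1} ∩ ({ρ | ρᴴ = ρ} ∩
        ⋂ p, {ρ | ρ * majorana p - majorana p * ρ =
          ∑ q, kappa ρ p q • (ρ * majorana q + majorana q * ρ)}) := by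
      ext ρ
      simp only [Set.mem_inter_iff, Set.mem_iInter, Set.mem_ofPred_eq]
      exact ⟨fun h => ⟨h.1, h.2, h.3⟩, fun h => ⟨h.1, h.2.1, h.2.2⟩⟩
    rw [this]
    refine (isClosed_eq ?_ ?_).inter ((isClosed_eq ?_ ?_).inter
      (isClosed_iInter fun p => isClosed_eq ?_ ?_))
    · exact continuous_id.matrix_trace
    · exact continuous_const
    · exact continuous_id.matrix_conjTranspose
    · exact continuous_id
    · fun_prop
    · simp only [kappa, Matrix.of_apply]
      fun_prop
  exact closure_minimal hsub hcl h

end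

/-! ### Generation of the full operator algebra and the algebras of single modes -/

section

variable {N : ℕ}

lemma majorana_zero_mul_one (k : Fin N) :
    majorana (k, 0) * majorana (k, 1) =
      Matrix.diagonal fun s : Occ N => Complex.I * (-1) ^ (s k : ℕ) := by
  rw [majorana_zero_eq, majorana_one_eq, mono_mul, single_add_single, mono_zero_right]
  congr 1; ext s
  rw [sgn_add_single, sgn_Iic]
  simp only [Finset.mem_Iio, lt_irrefl, if_false]
  linear_combination Complex.I * (-1) ^ (s k : ℕ) * sgn_mul_self (Finset.Iio k) s

/-- The indicator of a Fock basis state is a product of one-mode spectral projections, hence a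
polynomial in the number signs. -/
lemma prod_half_one_add (s₀ : Occ N) :
    (∏ k, fun s : Occ N => (2⁻¹ : ℂ) * (1 + (-1) ^ (s₀ k : ℕ) * (-1) ^ (s k : ℕ))) =
      Pi.single s₀ 1 := by
  ext s
  have h : ∀ a b : Fin 2, (2⁻¹ : ℂ) * (1 + (-1) ^ (a : ℕ) * (-1) ^ (b : ℕ)) =
      if b = a then 1 else 0 := by
    intro a b
    fin_cases a <;> fin_cases b <;> norm_num
  simp only [Finset.prod_apply, h]
  rw [Finset.prod_ite_zero]
  simp [Pi.single_apply, funext_iff]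

lemma diagonal_mem {S : Subalgebra ℂ (Op N)}
    (h : ∀ k, majorana (k, 0) * majorana (k, 1) ∈ S) (f : Occ N → ℂ) :
    Matrix.diagonal f ∈ S := by
  let D : Subalgebra ℂ (Occ N → ℂ) := S.comap (Matrix.diagonalAlgHom ℂ)
  have h1 : ∀ k, (fun s : Occ N => (-1 : ℂ) ^ (s k : ℕ)) ∈ D := by
    intro k
    have := S.smul_mem (h k) (-Complex.I)
    rw [majorana_zero_mul_one, ← Matrix.diagonal_smul] at this
    have e : (fun s : Occ N => (-1 : ℂ) ^ (s k : ℕ)) =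
        -Complex.I • fun s : Occ N => Complex.I * (-1) ^ (s k : ℕ) := by
      ext s
      simp [← mul_assoc]
    rw [e]
    exact this
  have h2 : ∀ s₀ : Occ N, Pi.single s₀ (1 : ℂ) ∈ D := by
    intro s₀
    rw [← prod_half_one_add]
    refine D.prod_mem fun k _ => ?_
    exact D.smul_mem (D.add_mem D.one_mem (D.smul_mem (h1 k) ((-1) ^ (s₀ k : ℕ)))) 2⁻¹
  have h3 : f ∈ D := by
    have : f = ∑ s, f s • Pi.single s (1 : ℂ) := by
      ext t
      simp [Finset.sum_apply, Pi.single_apply]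
    rw [this]
    exact D.sum_mem fun s _ => D.smul_mem (h2 s) _
  exact h3

/-- The first hypothesis gives all diagonal operators. These cut matrix units out of a weighted
one-mode flip, provided no weight vanishes, and products of such units reach every matrix unit. -/
lemma eq_top_of_mem {S : Subalgebra ℂ (Op N)}
    (h : ∀ k, majorana (k, 0) * majorana (k, 1) ∈ S)
    (h' : ∀ k, ∃ f : Occ N → ℂ, (∀ s, f s ≠ 0) ∧ mono f (Pi.single k 1) ∈ S) : S = ⊤ := by
  have hd := diagonal_mem h
  let V : AddSubmonoid (Occ N) :=
    { carrier := {v | ∀ s : Occ N, Matrix.single (s + v) s (1 : ℂ) ∈ S}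
      zero_mem' := fun s => by
        rw [add_zero, ← Matrix.diagonal_single]
        exact hd _
      add_mem' := fun {v w} hv hw s => by
        have := S.mul_mem (hw (s + v)) (hv s)
        rwa [Matrix.single_mul_single_same, mul_one, add_assoc] at this }
  have h1 : ∀ k, (Pi.single k 1 : Occ N) ∈ V := by
    intro k s
    obtain ⟨f, hf, hmem⟩ := h' k
    have h2 := S.smul_mem (S.mul_mem hmem (hd (Pi.single s 1))) (f s)⁻¹
    convert h2 using 1
    ext t u
    rw [Matrix.smul_apply, Matrix.mul_diagonal, mono, Matrix.of_apply, Matrix.single_apply]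
    by_cases hu : u = s
    · subst hu
      by_cases ht : t = u + Pi.single k 1
      · simp [ht, hf]
      · simp [ht, Ne.symm ht]
    · simp [hu, Ne.symm hu]
  have h2 : ∀ v, v ∈ V := by
    intro v
    rw [← Finset.univ_sum_single v]
    refine V.sum_mem fun k _ => ?_
    have : v k = 0 ∨ v k = 1 := by generalize v k = x; fin_cases x <;> simp
    rcases this with h | h
    · rw [h, Pi.single_zero]; exact V.zero_mem
    · rw [h]; exact h1 k
  rw [eq_top_iff]
  intro X _
  rw [Matrix.matrix_eq_sum_single X]
  refine S.sum_mem fun t _ => S.sum_mem fun s _ => ?_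
  have h3 := S.smul_mem (h2 (t - s) s) (X t s)
  rwa [add_sub_cancel, Matrix.smul_single, smul_eq_mul, mul_one] at h3

lemma eq_top_of_majorana_mem {S : Subalgebra ℂ (Op N)} (h : ∀ p, majorana p ∈ S) : S = ⊤ := by
  refine eq_top_of_mem (fun k => S.mul_mem (h _) (h _)) fun k =>
    ⟨sgn (Finset.Iio k), sgn_ne_zero _, ?_⟩
  rw [← majorana_zero_eq]
  exact h _

/-- The operators P c_p are the ones whose multiplications the Choi operator controls. They still
generate everything, since (P c₀)(P c₁) = -c₀ c₁. -/
lemma eq_top_of_parity_mul_majorana_mem {S : Subalgebra ℂ (Op N)}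
    (h : ∀ p, parity N * majorana p ∈ S) : S = ⊤ := by
  refine eq_top_of_mem (fun k => ?_) fun k =>
    ⟨fun s => sgn Finset.univ (s + Pi.single k 1) * sgn (Finset.Iio k) s,
      fun s => mul_ne_zero (sgn_ne_zero _ _) (sgn_ne_zero _ _), ?_⟩
  · have h1 := S.neg_mem (S.mul_mem (h (k, 0)) (h (k, 1)))
    rwa [← mul_assoc, parity_conj_majorana, neg_mul, neg_neg] at h1
  · have h1 := h (k, 0)
    rwa [majorana_zero_eq, parity_eq_mono, mono_mul, zero_add] at h1

lemma majorana_mem_modeAlgebra {S : Finset (Fin N)} {k : Fin N} (hk : k ∈ S) (a : Fin 2) :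
    majorana (k, a) ∈ modeAlgebra S :=
  Algebra.subset_adjoin ⟨k, hk, a, rfl⟩

lemma parity_conj_mem_modeAlgebra {S : Finset (Fin N)} {Y : Op N} (hY : Y ∈ modeAlgebra S) :
    parity N * Y * parity N ∈ modeAlgebra S := by
  induction hY using Algebra.adjoin_induction with
  | mem x hx =>
    obtain ⟨k, hk, a, rfl⟩ := hx
    rw [parity_conj_majorana]
    exact Subalgebra.neg_mem _ (majorana_mem_modeAlgebra hk a)
  | algebraMap r =>
    rw [← Algebra.commutes, mul_assoc, parity_sq, mul_one]
    exact Subalgebra.algebraMap_mem _ r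
  | add x y _ _ hx hy =>
    rw [mul_add, add_mul]
    exact Subalgebra.add_mem _ hx hy
  | mul x y _ _ hx hy =>
    have : parity N * (x * y) * parity N =
        (parity N * x * parity N) * (parity N * y * parity N) := by
      simp only [mul_assoc]
      rw [← mul_assoc (parity N) (parity N), parity_sq, one_mul]
    rw [this]
    exact Subalgebra.mul_mem _ hx hy

/-- The parity factor cancels the sign of anticommutation. The twisted operator therefore commutes
with all operators on other modes, odd ones included. -/
lemma commute_parity_mul_majorana {S : Finset (Fin N)} {i : Fin N} (hi : i ∉ S) (a : Fin 2)
    {Y : Op N} (hY : Y ∈ modeAlgebra S) : Commute (parity N * majorana (i, a)) Y := by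
  induction hY using Algebra.adjoin_induction with
  | mem x hx =>
    obtain ⟨k, hk, b, rfl⟩ := hx
    have h : ((i, a) : Fin N × Fin 2) ≠ (k, b) := by
      rintro ⟨⟩
      exact hi hk
    rw [commute_iff_eq, mul_assoc, majorana_anticomm h, mul_neg, ← mul_assoc, parity_mul_majorana,
      neg_mul, neg_neg, mul_assoc]
  | algebraMap r => exact (Algebra.commutes r _).symm
  | add x y _ _ hx hy => exact hx.add_right hy
  | mul x y _ _ hx hy => exact hx.mul_right hy

lemma majorana_mul_of_mem_modeAlgebra {S : Finset (Fin N)} {i : Fin N} (hi : i ∉ S) (a : Fin 2)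
    {Y : Op N} (hY : Y ∈ modeAlgebra S) :
    majorana (i, a) * Y = parity N * Y * parity N * majorana (i, a) := by
  have h := (commute_parity_mul_majorana hi a hY).eq
  rw [mul_assoc (parity N * Y), mul_assoc (parity N) Y, ← h, mul_assoc, ← mul_assoc (parity N),
    parity_sq, one_mul]

/-- Every operator is a combination of `1`, `c₀`, `c₁`, `c₀ c₁` with coefficients in the algebra of
the other modes. -/
lemma exists_decomposition (i : Fin N) (X : Op N) :
    ∃ Y : Fin 4 → Op N, (∀ j, Y j ∈ modeAlgebra ({i}ᶜ : Finset (Fin N))) ∧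
      X = Y 0 + Y 1 * majorana (i, 0) + Y 2 * majorana (i, 1) +
        Y 3 * (majorana (i, 0) * majorana (i, 1)) := by
  have hi : i ∉ ({i}ᶜ : Finset (Fin N)) := by simp
  set M := modeAlgebra ({i}ᶜ : Finset (Fin N)) with hM
  set c := majorana (i, 0) with hc
  set d := majorana (i, 1) with hd
  have hcc : c * c = 1 := majorana_sq _
  have hdd : d * d = 1 := majorana_sq _
  have hdc : d * c = -(c * d) := majorana_anticomm (by simp)
  let D : Op N → Prop := fun X => ∃ Y : Fin 4 → Op N, (∀ j, Y j ∈ M) ∧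
    X = Y 0 + Y 1 * c + Y 2 * d + Y 3 * (c * d)
  have hadd : ∀ X Y, D X → D Y → D (X + Y) := by
    rintro _ _ ⟨Y, hY, rfl⟩ ⟨Z, hZ, rfl⟩
    refine ⟨Y + Z, fun j => M.add_mem (hY j) (hZ j), ?_⟩
    simp only [Pi.add_apply]
    noncomm_ring
  have hmul : ∀ m ∈ M, ∀ X, D X → D (m * X) := by
    rintro m hm _ ⟨Y, hY, rfl⟩
    refine ⟨fun j => m * Y j, fun j => M.mul_mem hm (hY j), ?_⟩
    noncomm_ring
  -- A Majorana operator of mode `i` passes a coefficient at the cost of a parity conjugation, then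
  -- permutes the basis `1, c, d, c * d` up to sign; one of another mode only changes the
  -- coefficients.
  have hgen : ∀ p : Fin N × Fin 2, ∀ X, D X → D (majorana p * X) := by
    rintro ⟨k, a⟩ X hX
    by_cases hk : k = i
    · subst hk
      obtain ⟨Y, hY, rfl⟩ := hX
      have hZ : ∀ j, parity N * Y j * parity N ∈ M := fun j => parity_conj_mem_modeAlgebra (hY j)
      have hcY : ∀ j, c * Y j = parity N * Y j * parity N * c :=
        fun j => majorana_mul_of_mem_modeAlgebra hi 0 (hY j)
      have hdY : ∀ j, d * Y j = parity N * Y j * parity N * d :=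
        fun j => majorana_mul_of_mem_modeAlgebra hi 1 (hY j)
      generalize hZZ : (fun j => parity N * Y j * parity N) = Z at *
      have hZ' : ∀ j, parity N * Y j * parity N = Z j := fun j => congrFun hZZ j
      simp only [hZ'] at hZ hcY hdY
      fin_cases a
      · refine ⟨![Z 1, Z 0, Z 3, Z 2], by simpa [Fin.forall_fin_succ] using
          ⟨hZ 1, hZ 0, hZ 3, hZ 2⟩, ?_⟩
        change c * _ = Z 1 + Z 0 * c + Z 3 * d + Z 2 * (c * d)
        simp only [mul_add, ← mul_assoc, hcY]
        rw [mul_assoc (Z 1), hcc, mul_assoc (Z 3), hcc]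
        noncomm_ring
      · refine ⟨![Z 2, -Z 3, Z 0, -Z 1], by simpa [Fin.forall_fin_succ] using
          ⟨hZ 2, hZ 3, hZ 0, hZ 1⟩, ?_⟩
        change d * _ = Z 2 + -Z 3 * c + Z 0 * d + -Z 1 * (c * d)
        simp only [mul_add, ← mul_assoc, hdY]
        rw [mul_assoc (Z 1), hdc, mul_assoc (Z 2), hdd, mul_assoc (Z 3), hdc, mul_assoc (Z 3),
          neg_mul, mul_assoc c, hdd]
        noncomm_ring
    · exact hmul _ (majorana_mem_modeAlgebra (by simpa using hk) a) X hX
  have htop : Algebra.adjoin ℂ (Set.range (majorana (N := N))) = ⊤ :=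
    eq_top_of_majorana_mem fun p => Algebra.subset_adjoin ⟨p, rfl⟩
  have hall : ∀ X, ∀ Z, D Z → D (X * Z) := by
    intro X
    have hX : X ∈ Algebra.adjoin ℂ (Set.range (majorana (N := N))) := by simp [htop]
    induction hX using Algebra.adjoin_induction with
    | mem x hx =>
      obtain ⟨p, rfl⟩ := hx
      exact hgen p
    | algebraMap r => exact hmul _ (M.algebraMap_mem r)
    | add x y _ _ hx hy =>
      intro Z hZ
      rw [add_mul]
      exact hadd _ _ (hx Z hZ) (hy Z hZ)
    | mul x y _ _ hx hy =>
      intro Z hZ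
      rw [mul_assoc]
      exact hx _ (hy Z hZ)
  have h1 : D 1 := ⟨![1, 0, 0, 0], by simp [Fin.forall_fin_succ], by simp⟩
  simpa using hall X 1 h1

lemma eq_zero_of_anticommute {Z e : Op N} (hZ : e * Z = -(Z * e)) (hZ' : e * Z = Z * e)
    (he : IsUnit e) : Z = 0 := by
  have h : Z * e = -(Z * e) := hZ'.symm.trans hZ
  have h2 : Z * e = 0 := by
    ext i j
    have := congrFun (congrFun h i) j
    rw [Matrix.neg_apply] at this
    exact self_eq_neg.mp this
  exact (he.mul_left_eq_zero).mp h2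

lemma parity_mul_majorana_mul (p q : Fin N × Fin 2) :
    parity N * majorana p * majorana q =
      (if p = q then (-1 : ℂ) else 1) • (majorana q * (parity N * majorana p)) := by
  split_ifs with h
  · subst h
    rw [← mul_assoc, ← neg_eq_iff_eq_neg.mpr (parity_mul_majorana p)]
    simp
  · rw [mul_assoc, majorana_anticomm h, mul_neg, ← mul_assoc, parity_mul_majorana]
    simp [mul_assoc]

lemma isUnit_parity_mul_majorana (p : Fin N × Fin 2) : IsUnit (parity N * majorana p) :=
  (IsUnit.of_mul_eq_one _ parity_sq).mul (IsUnit.of_mul_eq_one _ (majorana_sq p))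

/-- P c₀ commutes with `X`, with the coefficients of the decomposition and with c₁, but anticommutes
with c₀: the terms containing c₀ vanish. P c₁ then removes the remaining c₁ term. -/
lemma mem_modeAlgebra_compl {i : Fin N} {X : Op N} (hP : Commute X (parity N))
    (hX : ∀ a, Commute X (majorana (i, a))) : X ∈ modeAlgebra ({i}ᶜ : Finset (Fin N)) := by
  have hi : i ∉ ({i}ᶜ : Finset (Fin N)) := by simp
  obtain ⟨Y, hY, hXY⟩ := exists_decomposition i X
  have hc : ∀ a, Commute (parity N * majorana (i, a)) X := fun a => (hP.mul_right (hX a)).symm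
  have hYc : ∀ a j, Commute (parity N * majorana (i, a)) (Y j) :=
    fun a j => commute_parity_mul_majorana hi a (hY j)
  have e00 := parity_mul_majorana_mul ((i, 0) : Fin N × Fin 2) (i, 0)
  have e01 := parity_mul_majorana_mul ((i, 0) : Fin N × Fin 2) (i, 1)
  have e11 := parity_mul_majorana_mul ((i, 1) : Fin N × Fin 2) (i, 1)
  simp only [if_true, Prod.mk.injEq, true_and, zero_ne_one, if_false, one_smul, neg_smul] at e00 e01 e11
  have hu0 := isUnit_parity_mul_majorana ((i, 0) : Fin N × Fin 2)
  have hu1 := isUnit_parity_mul_majorana ((i, 1) : Fin N × Fin 2)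
  have hc0 := hc 0
  have hc1 := hc 1
  have hY0 := hYc 0
  have hY1 := hYc 1
  generalize parity N * majorana (i, 0) = e at *
  generalize parity N * majorana (i, 1) = f at *
  generalize majorana (i, 0) = c at *
  generalize majorana (i, 1) = d at *
  have z1 : Y 1 * c + Y 3 * (c * d) = 0 := by
    apply eq_zero_of_anticommute (e := e) _ _ hu0
    · rw [mul_add, ← mul_assoc, (hY0 1).eq, ← mul_assoc, (hY0 3).eq, mul_assoc, e00, mul_assoc,
        ← mul_assoc e, e00, neg_mul, mul_assoc c, e01]
      noncomm_ring
    · have h1 : Y 1 * c + Y 3 * (c * d) = X - Y 0 - Y 2 * d := by rw [hXY]; abel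
      rw [h1]
      exact ((hc0.sub_right (hY0 0)).sub_right ((hY0 2).mul_right e01)).eq
  have hX2 : X = Y 0 + Y 2 * d := by
    rw [hXY, ← sub_eq_zero, ← z1]; abel
  have z2 : Y 2 * d = 0 := by
    apply eq_zero_of_anticommute (e := f) _ _ hu1
    · rw [← mul_assoc, (hY1 2).eq, mul_assoc, e11]
      noncomm_ring
    · have h1 : Y 2 * d = X - Y 0 := by rw [hX2]; abel
      rw [h1]
      exact (hc1.sub_right (hY1 0)).eq
  rw [hX2, z2, add_zero]
  exact hY 0

end

/-! ### Pure states from which a single mode factors out -/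

section

variable {N : ℕ}

lemma mul_proj (X : Op N) (ψ : Occ N → ℂ) : X * proj ψ = Matrix.vecMulVec (X *ᵥ ψ) (star ψ) :=
  Matrix.mul_vecMulVec _ _ _

lemma proj_conjTranspose (ψ : Occ N → ℂ) : (proj ψ)ᴴ = proj ψ := by
  rw [proj, Matrix.conjTranspose_vecMulVec, star_star]

lemma proj_mulVec_self {ψ : Occ N → ℂ} (h : star ψ ⬝ᵥ ψ = 1) : proj ψ *ᵥ ψ = ψ := by
  rw [proj, Matrix.vecMulVec_mulVec, h]
  simp

lemma IsPureState.exists_parity_mulVec {ψ : Occ N → ℂ} (h : IsPureState ψ) :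
    ∃ l : ℂ, l ≠ 0 ∧ parity N *ᵥ ψ = l • ψ := by
  have h0 : ψ ≠ 0 := by
    rintro rfl
    simpa using h.norm_eq_one
  have h1 : parity N *ᵥ ψ = (star ψ ⬝ᵥ (parity N *ᵥ ψ)) • ψ := by
    have h2 : parity N *ᵥ (proj ψ *ᵥ ψ) = proj ψ *ᵥ (parity N *ᵥ ψ) := by
      rw [Matrix.mulVec_mulVec, Matrix.mulVec_mulVec, h.fermionic.eq]
    rw [proj_mulVec_self h.norm_eq_one, proj, Matrix.vecMulVec_mulVec] at h2
    simpa using h2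
  refine ⟨_, ?_, h1⟩
  intro hl
  rw [hl, zero_smul] at h1
  apply h0
  rw [← Matrix.one_mulVec ψ, ← parity_sq, ← Matrix.mulVec_mulVec, h1, Matrix.mulVec_zero]

/-- A pure state annihilated by `c₁ - w c₀`, `w = ± i`, has a factor on mode `i`. -/
lemma factorizesAcross_of_mulVec {ψ : Occ N → ℂ} (h : IsPureState ψ) {i : Fin N} {w : ℂ}
    (hw : w = Complex.I ∨ w = -Complex.I)
    (hψ : majorana (i, 1) *ᵥ ψ = w • (majorana (i, 0) *ᵥ ψ)) :
    FactorizesAcross {i} (proj ψ) := by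
  have hw2 : w * w = -1 := by rcases hw with rfl | rfl <;> simp
  have hws : star w = -w := by rcases hw with rfl | rfl <;> simp
  have hcm : majorana (i, 0) ∈ modeAlgebra {i} := majorana_mem_modeAlgebra (by simp) 0
  have hdm : majorana (i, 1) ∈ modeAlgebra {i} := majorana_mem_modeAlgebra (by simp) 1
  have hcc := majorana_sq ((i, 0) : Fin N × Fin 2)
  have hdd := majorana_sq ((i, 1) : Fin N × Fin 2)
  have hdc : majorana (i, 1) * majorana (i, 0) = -(majorana (i, 0) * majorana (i, 1)) :=
    majorana_anticomm (by simp)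
  have hcs := majorana_conjTranspose ((i, 0) : Fin N × Fin 2)
  have hds := majorana_conjTranspose ((i, 1) : Fin N × Fin 2)
  have hPc := parity_mul_majorana ((i, 0) : Fin N × Fin 2)
  have hPd := parity_mul_majorana ((i, 1) : Fin N × Fin 2)
  have hdp : majorana (i, 1) * proj ψ = w • (majorana (i, 0) * proj ψ) := by
    rw [mul_proj, mul_proj, hψ, Matrix.smul_vecMulVec]
  have hmem := mem_modeAlgebra_compl (i := i) (X := proj ψ + majorana (i, 0) * proj ψ * majorana (i, 0))
  rw [Fin.forall_fin_two] at hmem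
  have hps : (proj ψ).PosSemidef := Matrix.posSemidef_vecMulVec_self_star ψ
  have hpp := proj_conjTranspose ψ
  have hpP := h.fermionic
  generalize majorana (i, 0) = c at *
  generalize majorana (i, 1) = d at *
  generalize proj ψ = p at *
  have hpd : p * d = -w • (p * c) := by
    have := congrArg Matrix.conjTranspose hdp
    rwa [Matrix.conjTranspose_mul, Matrix.conjTranspose_smul, Matrix.conjTranspose_mul, hpp, hcs,
      hds, hws] at this
  have hpcd : p * (c * d) = w • p := by
    rw [← neg_eq_iff_eq_neg.mpr hdc, mul_neg, ← mul_assoc, hpd, smul_mul_assoc, mul_assoc, hcc,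
      mul_one, neg_smul, neg_neg]
  have hcdp : c * (d * p) = w • p := by
    rw [hdp, mul_smul_comm, ← mul_assoc, hcc, one_mul]
  have hdcp : d * (c * p) = -(w • p) := by
    rw [← mul_assoc, hdc, neg_mul, mul_assoc, hcdp]
  have hcPc : Commute (c * p * c) (parity N) := by
    have h1 : c * (p * (c * parity N)) = parity N * (c * (p * c)) := by
      rw [← neg_eq_iff_eq_neg.mpr hPc, mul_neg, ← mul_assoc p, hpP.eq, mul_assoc, mul_neg,
        ← mul_assoc c, ← neg_eq_iff_eq_neg.mpr hPc, neg_mul, neg_neg, mul_assoc]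
    rw [commute_iff_eq, mul_assoc, mul_assoc, mul_assoc]
    rw [h1]
  have hBP : Commute (p + c * p * c) (parity N) := hpP.add_left hcPc
  have hcd : c * d * (c * d) = -1 := by
    rw [mul_assoc, ← mul_assoc d, hdc, neg_mul, mul_assoc c, hdd, mul_one, mul_neg, hcc]
  -- The hypothesis makes ψ an eigenvector of `c * d` with eigenvalue `w`, and `A` is the spectral
  -- projection for `w`. It fixes `p` and kills `c * p * c`, which has the opposite eigenvalue. The
  -- sum `p + c * p * c` is the factor on the other modes: it commutes with both `c` and `d`.
  set A := (2⁻¹ : ℂ) • (1 - w • (c * d)) with hA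
  have hAs : Aᴴ = A := by
    rw [hA, Matrix.conjTranspose_smul, Matrix.conjTranspose_sub, Matrix.conjTranspose_smul,
      Matrix.conjTranspose_mul, hcs, hds, hdc, hws]
    simp
  have hAA : A * A = A := by
    rw [hA, smul_mul_smul_comm, mul_sub, sub_mul, sub_mul, smul_mul_smul_comm, hcd, hw2]
    simp only [mul_one, one_mul, smul_neg, neg_smul, one_smul, neg_neg]
    rw [show (1 : Op N) - w • (c * d) - (w • (c * d) - 1) = (2 : ℂ) • (1 - w • (c * d)) by
      rw [two_smul]; abel, smul_smul]
    norm_num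
  have hcdP : Commute (c * d) (parity N) := by
    rw [commute_iff_eq, mul_assoc, ← neg_eq_iff_eq_neg.mpr hPd, mul_neg, ← mul_assoc,
      ← neg_eq_iff_eq_neg.mpr hPc]
    simp [mul_assoc]
  refine ⟨A, ?_, p + c * p * c, hmem hBP ⟨?_, ?_⟩, ?_, ?_, ?_, hBP, ?_⟩
  · exact Subalgebra.smul_mem _ (Subalgebra.sub_mem _ (Subalgebra.one_mem _)
      (Subalgebra.smul_mem _ (Subalgebra.mul_mem _ hcm hdm) _)) _
  · rw [commute_iff_eq, add_mul, mul_add, mul_assoc _ c c, hcc, mul_one, mul_assoc c p c,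
      ← mul_assoc c c, hcc, one_mul, add_comm]
  · rw [commute_iff_eq, add_mul, mul_add, hpd, hdp, mul_assoc (c * p) c d, mul_assoc c p, hpcd,
      ← mul_assoc d (c * p), hdcp]
    simp only [neg_smul, mul_smul_comm, smul_mul_assoc, neg_mul]
    abel
  · have := Matrix.posSemidef_self_mul_conjTranspose A
    rwa [hAs, hAA] at this
  · refine hps.add ?_
    have := hps.mul_mul_conjTranspose_same c
    rwa [hcs] at this
  · exact ((Commute.one_left _).sub_left (hcdP.smul_left _)).smul_left _
  · have h1 : c * d * (p + c * p * c) = w • (p - c * p * c) := by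
      rw [mul_add, mul_assoc c d p, hcdp, mul_assoc c d, ← mul_assoc d (c * p), hdcp]
      simp only [smul_mul_assoc, neg_mul, mul_neg, mul_smul_comm, smul_sub, mul_assoc]
      abel
    rw [hA, smul_mul_assoc, sub_mul, one_mul, smul_mul_assoc, h1, smul_smul, hw2, neg_one_smul,
      show p + c * p * c - -(p - c * p * c) = (2 : ℂ) • p by rw [two_smul]; abel, smul_smul]
    norm_num

/-- If a pure state is an eigenvector of a nonzero combination of the Majorana operators of one
mode, then this mode factorizes. -/
lemma factorizesAcross_of_eigenvector {ψ : Occ N → ℂ} (h : IsPureState ψ) {i : Fin N}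
    {x : Fin 2 → ℂ} (hx : x ≠ 0) {m : ℂ}
    (hψ : (∑ a, x a • majorana (i, a)) *ᵥ ψ = m • ψ) :
    FactorizesAcross {i} (proj ψ) := by
  have h0 : ψ ≠ 0 := by
    rintro rfl
    simpa using h.norm_eq_one
  obtain ⟨l, hl, hP⟩ := h.exists_parity_mulVec
  have hcc := majorana_sq ((i, 0) : Fin N × Fin 2)
  have hdd := majorana_sq ((i, 1) : Fin N × Fin 2)
  have hdc : majorana (i, 1) * majorana (i, 0) = -(majorana (i, 0) * majorana (i, 1)) :=
    majorana_anticomm (by simp)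
  have hanti : parity N * (∑ a, x a • majorana (i, a)) =
      -((∑ a, x a • majorana (i, a)) * parity N) := by
    simp only [Finset.mul_sum, Finset.sum_mul, mul_smul_comm, smul_mul_assoc, parity_mul_majorana,
      smul_neg, Finset.sum_neg_distrib]
  have hsq : (∑ a, x a • majorana (i, a)) * (∑ a, x a • majorana (i, a)) =
      (x 0 * x 0 + x 1 * x 1) • (1 : Op N) := by
    simp only [Fin.sum_univ_two, add_mul, mul_add, smul_mul_smul_comm, hcc, hdd, hdc, smul_neg,
      add_smul, mul_comm (x 1) (x 0)]
    abel
  -- The combination is odd and ψ has definite parity, so the eigenvalue equals its own negative.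
  have hm : m = 0 := by
    have h1 : parity N *ᵥ ((∑ a, x a • majorana (i, a)) *ᵥ ψ) = -(l • m • ψ) := by
      rw [Matrix.mulVec_mulVec, hanti, Matrix.neg_mulVec, ← Matrix.mulVec_mulVec, hP,
        Matrix.mulVec_smul, hψ]
    rw [hψ, Matrix.mulVec_smul, hP, eq_neg_iff_add_eq_zero, smul_smul, smul_smul, ← add_smul] at h1
    have h2 := (smul_eq_zero.mp h1).resolve_right h0
    rw [mul_comm l, ← two_mul] at h2
    simpa [hl] using h2
  rw [hm, zero_smul] at hψ
  -- The square of the combination is a scalar; since it annihilates ψ, `x` is isotropic, which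
  -- forces the ratio of its entries to be ± i.
  have hx2 : x 0 * x 0 + x 1 * x 1 = 0 := by
    have h1 := congrArg ((∑ a, x a • majorana (i, a)) *ᵥ ·) hψ
    simp only [Matrix.mulVec_mulVec, hsq, Matrix.smul_mulVec, Matrix.one_mulVec,
      Matrix.mulVec_zero] at h1
    exact (smul_eq_zero.mp h1).resolve_right h0
  have hx1 : x 1 ≠ 0 := by
    intro h1
    apply hx
    ext a
    fin_cases a
    · simpa [h1] using hx2
    · exact h1
  refine factorizesAcross_of_mulVec h (w := -(x 0 / x 1)) ?_ ?_
  · have : (x 0 / x 1 - Complex.I) * (x 0 / x 1 + Complex.I) = 0 := by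
      have : x 0 * x 0 = - (x 1 * x 1) := by linear_combination hx2
      field_simp
      ring_nf
      rw [Complex.I_sq]
      linear_combination hx2
    rcases mul_eq_zero.mp this with h1 | h1
    · right; linear_combination -h1
    · left; linear_combination -h1
  · rw [Fin.sum_univ_two, Matrix.add_mulVec, Matrix.smul_mulVec, Matrix.smul_mulVec] at hψ
    have : majorana (i, 1) *ᵥ ψ = (x 1)⁻¹ • (x 1 • (majorana (i, 1) *ᵥ ψ)) := by
      rw [smul_smul, inv_mul_cancel₀ hx1, one_smul]
    rw [this, eq_neg_of_add_eq_zero_right hψ, smul_neg, smul_smul, neg_smul]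
    congr 2
    field_simp

end

/-! ### The maximally entangled state exchanges input and output Majorana operators -/

section

section MaxEntangled

/-- The element moves through the factors it commutes with until it reaches the first one that it
kills. -/
lemma mul_list_prod_eq_zero {A : Type*} [Ring A] {x : A} (L : List A)
    (h : ∀ f ∈ L, Commute x f ∨ x * f = 0) (h' : ∃ f ∈ L, x * f = 0) : x * L.prod = 0 := by
  induction L with
  | nil => simp at h'
  | cons g L ih =>
    rw [List.prod_cons, ← mul_assoc]
    by_cases h0 : x * g = 0
    · rw [h0, zero_mul]
    · have hc := (h g (by simp)).resolve_right h0
      obtain ⟨f, hf, hf0⟩ := h'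
      rw [List.mem_cons] at hf
      rcases hf with rfl | hf
      · exact absurd hf0 h0
      · rw [hc.eq, mul_assoc, ih (fun f hf => h f (by simp [hf])) ⟨f, hf, hf0⟩, mul_zero]

lemma list_prod_mul_eq_zero {A : Type*} [Ring A] {x : A} (L : List A)
    (h : ∀ f ∈ L, Commute f x ∨ f * x = 0) (h' : ∃ f ∈ L, f * x = 0) : L.prod * x = 0 := by
  induction L with
  | nil => simp at h'
  | cons g L ih =>
    rw [List.prod_cons, mul_assoc]
    by_cases h1 : ∃ f ∈ L, f * x = 0
    · rw [ih (fun f hf => h f (by simp [hf])) h1, mul_zero]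
    · have h2 : Commute L.prod x := by
        refine (Commute.list_prod_right L x fun f hf => ?_).symm
        exact ((h f (by simp [hf])).resolve_right fun h0 => h1 ⟨f, hf, h0⟩).symm
      obtain ⟨f, hf, hf0⟩ := h'
      rw [List.mem_cons] at hf
      rcases hf with rfl | hf
      · rw [h2.eq, ← mul_assoc, hf0, zero_mul]
      · exact absurd ⟨f, hf, hf0⟩ h1

variable {n : ℕ}

/-- The Majorana operators of the first `n` of `2n` modes. -/
noncomputable abbrev majoranaL (p : Fin n × Fin 2) : Op (n + n) := majorana (Fin.castAdd n p.1, p.2)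

/-- The Majorana operators of the last `n` of `2n` modes. -/
noncomputable abbrev majoranaR (p : Fin n × Fin 2) : Op (n + n) := majorana (Fin.natAdd n p.1, p.2)

/-- The factors of the maximally entangled state. -/
noncomputable def bell (p : Fin n × Fin 2) : Op (n + n) :=
  1 + Complex.I • (majoranaL p * majoranaR p)

lemma castAdd_ne_natAdd (k l : Fin n) : Fin.castAdd n k ≠ Fin.natAdd n l := by
  intro h
  have := congrArg Fin.val h
  simp at this
  omega

lemma majoranaL_mul_majoranaR (p q : Fin n × Fin 2) :
    majoranaL p * majoranaR q = -(majoranaR q * majoranaL p) :=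
  majorana_anticomm fun h => castAdd_ne_natAdd _ _ (congrArg Prod.fst h)

lemma majoranaL_anticomm {p q : Fin n × Fin 2} (h : p ≠ q) :
    majoranaL p * majoranaL q = -(majoranaL q * majoranaL p) := by
  refine majorana_anticomm fun h1 => h ?_
  simpa [Prod.ext_iff] using h1

lemma majoranaR_anticomm {p q : Fin n × Fin 2} (h : p ≠ q) :
    majoranaR p * majoranaR q = -(majoranaR q * majoranaR p) := by
  refine majorana_anticomm fun h1 => h ?_
  simpa [Prod.ext_iff] using h1

lemma commute_mul_of_anticommute {A : Type*} [Ring A] {x a b : A} (ha : x * a = -(a * x))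
    (hb : x * b = -(b * x)) : Commute x (a * b) := by
  rw [commute_iff_eq, ← mul_assoc, ha, neg_mul, mul_assoc, hb, mul_neg, neg_neg, mul_assoc]

lemma commute_bell {p q : Fin n × Fin 2} (h : p ≠ q) (z : ℂ) :
    Commute (majoranaR p + z • majoranaL p) (bell q) := by
  refine (Commute.one_right _).add_right (Commute.smul_right (Commute.add_left ?_
    (Commute.smul_left ?_ _)) _)
  · refine commute_mul_of_anticommute ?_ (majoranaR_anticomm h)
    rw [majoranaL_mul_majoranaR, neg_neg]
  · exact commute_mul_of_anticommute (majoranaL_anticomm h) (majoranaL_mul_majoranaR _ _)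

/-- `bell p` is twice the projection onto the eigenspace i c_L c_R = 1, on which c_R = -i c_L. -/
lemma mul_bell (p : Fin n × Fin 2) : (majoranaR p + Complex.I • majoranaL p) * bell p = 0 := by
  have h1 := majoranaL_mul_majoranaR p p
  have h2 : majoranaL p * majoranaL p = 1 := majorana_sq _
  have h3 : majoranaR p * majoranaR p = 1 := majorana_sq _
  have h4 : majoranaR p * (majoranaL p * majoranaR p) = -majoranaL p := by
    rw [h1, mul_neg, ← mul_assoc, h3, one_mul]
  have h5 : majoranaL p * (majoranaL p * majoranaR p) = majoranaR p := by
    rw [← mul_assoc, h2, one_mul]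
  rw [bell, mul_add, mul_one, add_mul, mul_smul_comm, smul_mul_smul_comm, h4, h5, Complex.I_mul_I]
  simp

lemma bell_mul (p : Fin n × Fin 2) : bell p * (majoranaR p + (-Complex.I) • majoranaL p) = 0 := by
  have h1 := majoranaL_mul_majoranaR p p
  have h2 : majoranaL p * majoranaL p = 1 := majorana_sq _
  have h3 : majoranaR p * majoranaR p = 1 := majorana_sq _
  have h4 : majoranaL p * majoranaR p * majoranaR p = majoranaL p := by
    rw [mul_assoc, h3, mul_one]
  have h5 : majoranaL p * majoranaR p * majoranaL p = -majoranaR p := by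
    rw [h1, neg_mul, mul_assoc, h2, mul_one]
  rw [bell, add_mul, one_mul, mul_add, smul_mul_assoc, smul_mul_smul_comm, h4, h5, mul_neg,
    Complex.I_mul_I]
  simp

lemma mul_bell_mul_bell (k : Fin n) (a : Fin 2) :
    (majoranaR (k, a) + Complex.I • majoranaL (k, a)) * (bell (k, 0) * bell (k, 1)) = 0 := by
  rw [← mul_assoc]
  obtain rfl | rfl : a = 0 ∨ a = 1 := by fin_cases a <;> simp
  · rw [mul_bell, zero_mul]
  · rw [(commute_bell (by simp) _).eq, mul_assoc, mul_bell, mul_zero]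

lemma bell_mul_bell_mul (k : Fin n) (a : Fin 2) :
    bell (k, 0) * bell (k, 1) * (majoranaR (k, a) + (-Complex.I) • majoranaL (k, a)) = 0 := by
  rw [mul_assoc]
  obtain rfl | rfl : a = 0 ∨ a = 1 := by fin_cases a <;> simp
  · rw [← (commute_bell (by simp) _).eq, ← mul_assoc, bell_mul, zero_mul]
  · rw [bell_mul, mul_zero]

lemma commute_bell_mul_bell {k l : Fin n} (h : k ≠ l) (a : Fin 2) (z : ℂ) :
    Commute (majoranaR (k, a) + z • majoranaL (k, a)) (bell (l, 0) * bell (l, 1)) :=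
  (commute_bell (by simp [h]) z).mul_right (commute_bell (by simp [h]) z)

/-- This is the fermionic transpose trick. The factor is -i from the left and i from the right, as
the two operators anticommute. -/
lemma majoranaR_mul_maxEntangled (p : Fin n × Fin 2) :
    majoranaR p * maxEntangled n = (-Complex.I) • (majoranaL p * maxEntangled n) := by
  obtain ⟨k, a⟩ := p
  have h : (majoranaR (k, a) + Complex.I • majoranaL (k, a)) *
      (List.ofFn fun k : Fin n => bell (k, 0) * bell (k, 1)).prod = 0 := by
    refine mul_list_prod_eq_zero _ (fun f hf => ?_) ⟨_, (List.mem_ofFn' _ _).mpr ⟨k, rfl⟩,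
      mul_bell_mul_bell k a⟩
    obtain ⟨l, rfl⟩ := (List.mem_ofFn' _ _).mp hf
    by_cases hl : k = l
    · subst hl
      exact Or.inr (mul_bell_mul_bell k a)
    · exact Or.inl (commute_bell_mul_bell hl a _)
  have h2 : maxEntangled n =
    ((4 : ℂ) ^ n)⁻¹ • (List.ofFn fun k : Fin n => bell (k, 0) * bell (k, 1)).prod := rfl
  rw [add_mul, smul_mul_assoc] at h
  rw [h2, mul_smul_comm, mul_smul_comm, smul_comm, eq_neg_of_add_eq_zero_left h, neg_smul]

lemma maxEntangled_mul_majoranaR (p : Fin n × Fin 2) :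
    maxEntangled n * majoranaR p = Complex.I • (maxEntangled n * majoranaL p) := by
  obtain ⟨k, a⟩ := p
  have h : (List.ofFn fun k : Fin n => bell (k, 0) * bell (k, 1)).prod *
      (majoranaR (k, a) + (-Complex.I) • majoranaL (k, a)) = 0 := by
    refine list_prod_mul_eq_zero _ (fun f hf => ?_) ⟨_, (List.mem_ofFn' _ _).mpr ⟨k, rfl⟩,
      bell_mul_bell_mul k a⟩
    obtain ⟨l, rfl⟩ := (List.mem_ofFn' _ _).mp hf
    by_cases hl : k = l
    · subst hl
      exact Or.inr (bell_mul_bell_mul k a)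
    · exact Or.inl (commute_bell_mul_bell hl a _).symm
  have h2 : maxEntangled n =
    ((4 : ℂ) ^ n)⁻¹ • (List.ofFn fun k : Fin n => bell (k, 0) * bell (k, 1)).prod := rfl
  rw [mul_add, mul_smul_comm, neg_smul] at h
  rw [h2, smul_mul_assoc, smul_mul_assoc, smul_comm, eq_neg_of_add_eq_zero_left h, neg_neg]

/-- Transferring both operators on the right reverses their order; transferring one on each side of
the state, by cyclicity of the trace, does not. Comparison shows that the input covariance vanishes.
-/
lemma trace_maxEntangled_comm (p q : Fin n × Fin 2) :
    (maxEntangled n * (majoranaR p * majoranaR q)).trace =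
      (maxEntangled n * (majoranaR q * majoranaR p)).trace := by
  have h1 : ∀ p q : Fin n × Fin 2, maxEntangled n * (majoranaR p * majoranaR q) =
      maxEntangled n * (majoranaL q * majoranaL p) := by
    intro p q
    rw [← mul_assoc, maxEntangled_mul_majoranaR, smul_mul_assoc, mul_assoc,
      majoranaL_mul_majoranaR, mul_neg, ← mul_assoc, maxEntangled_mul_majoranaR, smul_mul_assoc,
      smul_neg, smul_smul, Complex.I_mul_I, neg_one_smul, neg_neg, mul_assoc]
  have h2 : (maxEntangled n * (majoranaR p * majoranaR q)).trace =
      (maxEntangled n * (majoranaL p * majoranaL q)).trace := by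
    rw [← mul_assoc, maxEntangled_mul_majoranaR, smul_mul_assoc, Matrix.trace_smul,
      Matrix.trace_mul_comm, ← mul_assoc, majoranaR_mul_maxEntangled, smul_mul_assoc,
      Matrix.trace_smul, mul_assoc, Matrix.trace_mul_comm, smul_smul, mul_assoc]
    simp
  rw [h2, h1 q p]

end MaxEntangled

end

/-! ### Tensor splitting of the doubled Fock space and block calculus for ampliations -/

section

variable {n : ℕ}

/-- Operators on `2n` modes as operators on the tensor product of two Fock spaces. -/
noncomputable abbrev split (n : ℕ) :
    Op (n + n) ≃ₐ[ℂ] Matrix (Occ n × Occ n) (Occ n × Occ n) ℂ :=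
  Matrix.reindexAlgEquiv ℂ ℂ (Fin.appendEquiv n n).symm

lemma split_apply (X : Op (n + n)) (x y : Occ n × Occ n) :
    split n X x y = X (Fin.append x.1 x.2) (Fin.append y.1 y.2) := rfl

lemma append_eq_add_single_castAdd (x y : Occ n × Occ n) (k : Fin n) :
    Fin.append x.1 x.2 = Fin.append y.1 y.2 + Pi.single (Fin.castAdd n k) 1 ↔
      x.1 = y.1 + Pi.single k 1 ∧ x.2 = y.2 := by
  simp only [funext_iff, Fin.forall_fin_add, Fin.append_left, Fin.append_right, Pi.add_apply]
  refine and_congr (forall_congr' fun j => ?_) (forall_congr' fun j => ?_)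
  · simp [Pi.single_apply]
  · simp [(castAdd_ne_natAdd k j).symm, -Fin.natAdd_eq_addNat]

lemma append_eq_add_single_natAdd (x y : Occ n × Occ n) (k : Fin n) :
    Fin.append x.1 x.2 = Fin.append y.1 y.2 + Pi.single (Fin.natAdd n k) 1 ↔
      x.1 = y.1 ∧ x.2 = y.2 + Pi.single k 1 := by
  simp only [funext_iff, Fin.forall_fin_add, Fin.append_left, Fin.append_right, Pi.add_apply]
  refine and_congr (forall_congr' fun j => ?_) (forall_congr' fun j => ?_)
  · simp [castAdd_ne_natAdd j k, -Fin.natAdd_eq_addNat]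
  · simp [Pi.single_apply]

lemma sgn_eq_prod {N : ℕ} (T : Finset (Fin N)) (s : Occ N) :
    sgn T s = ∏ j, if j ∈ T then (-1 : ℂ) ^ (s j : ℕ) else 1 := by
  rw [sgn, Finset.prod_ite_mem, Finset.univ_inter]

lemma sgn_append (T : Finset (Fin (n + n))) (x y : Occ n) :
    sgn T (Fin.append x y) = (∏ j, if Fin.castAdd n j ∈ T then (-1 : ℂ) ^ (x j : ℕ) else 1) *
      ∏ j, if Fin.natAdd n j ∈ T then (-1 : ℂ) ^ (y j : ℕ) else 1 := by
  rw [sgn_eq_prod, Fin.prod_univ_add]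
  simp only [Fin.append_left, Fin.append_right]

lemma split_majoranaL (p : Fin n × Fin 2) :
    split n (majoranaL p) = majorana p ⊗ₖ (1 : Op n) := by
  obtain ⟨k, a⟩ := p
  have h1 : ∀ j, ¬ Fin.natAdd n j < Fin.castAdd n k := fun j h => by
    have := Fin.lt_def.mp h; simp at this; omega
  have h2 : ∀ j, ¬ Fin.natAdd n j ≤ Fin.castAdd n k := fun j h => by
    have := Fin.le_def.mp h; simp at this; omega
  have h3 : ∀ j, Fin.castAdd n j < Fin.castAdd n k ↔ j < k := fun j => Iff.rfl
  have h4 : ∀ j, Fin.castAdd n j ≤ Fin.castAdd n k ↔ j ≤ k := fun j => Iff.rfl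
  ext x y
  obtain rfl | rfl : a = 0 ∨ a = 1 := by fin_cases a <;> simp
  · rw [split_apply, majoranaL, majorana_zero_eq, majorana_zero_eq]
    simp only [mono, Matrix.of_apply, append_eq_add_single_castAdd, Matrix.kroneckerMap_apply,
      Matrix.one_apply, ite_and, mul_ite, mul_one, mul_zero, sgn_append, Finset.mem_Iio, h1, h3,
      if_false, Finset.prod_const_one]
    by_cases hx : x.2 = y.2 <;> simp [hx, sgn_eq_prod]
  · rw [split_apply, majoranaL, majorana_one_eq, majorana_one_eq]
    simp only [mono, Matrix.of_apply, append_eq_add_single_castAdd, Matrix.kroneckerMap_apply,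
      Matrix.one_apply, ite_and, mul_ite, mul_one, mul_zero, sgn_append, Finset.mem_Iic, h2, h4,
      if_false, Finset.prod_const_one]
    by_cases hx : x.2 = y.2 <;> simp [hx, sgn_eq_prod]

/-- The Jordan–Wigner string of an input mode runs over all output modes, which produces the full
parity on the first factor. -/
lemma split_majoranaR (p : Fin n × Fin 2) :
    split n (majoranaR p) = parity n ⊗ₖ majorana p := by
  obtain ⟨k, a⟩ := p
  have h1 : ∀ j, Fin.castAdd n j < Fin.natAdd n k := fun j => by
    rw [Fin.lt_def]; simp; omega
  have h2 : ∀ j, Fin.castAdd n j ≤ Fin.natAdd n k := fun j => (h1 j).le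
  ext x y
  obtain rfl | rfl : a = 0 ∨ a = 1 := by fin_cases a <;> simp
  · rw [split_apply, majoranaR, majorana_zero_eq, majorana_zero_eq, parity_eq_mono]
    simp only [mono, Matrix.of_apply, append_eq_add_single_natAdd, Matrix.kroneckerMap_apply,
      sgn_append, Finset.mem_Iio, h1, add_zero]
    by_cases hx : x.1 = y.1 <;> simp [hx, sgn_eq_prod]
  · rw [split_apply, majoranaR, majorana_one_eq, majorana_one_eq, parity_eq_mono]
    simp only [mono, Matrix.of_apply, append_eq_add_single_natAdd, Matrix.kroneckerMap_apply,
      sgn_append, Finset.mem_Iic, h2, add_zero]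
    by_cases hx : x.1 = y.1 <;> simp [hx, sgn_eq_prod, mul_left_comm]

section Ampliation
variable {κ : Type*}

/-- The blocks of an operator on (Fock space) ⊗ ℂ^κ. -/
def block (M : Matrix (Occ n × κ) (Occ n × κ) ℂ) (u v : κ) : Op n :=
  M.submatrix (·, u) (·, v)

lemma block_ampliation (E : Op n →ₗ[ℂ] Op n) (M : Matrix (Occ n × κ) (Occ n × κ) ℂ) (u v : κ) :
    block (ampliation E M) u v = E (block M u v) := rfl

lemma ext_block {M M' : Matrix (Occ n × κ) (Occ n × κ) ℂ} (h : ∀ u v, block M u v = block M' u v) :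
    M = M' := by
  ext x y
  exact congrFun (congrFun (h x.2 y.2) x.1) y.1

lemma block_smul (a : ℂ) (M : Matrix (Occ n × κ) (Occ n × κ) ℂ) (u v : κ) :
    block (a • M) u v = a • block M u v := rfl

lemma trace_ampliation [Fintype κ] {E : Op n →ₗ[ℂ] Op n} (hE : ∀ X, (E X).trace = X.trace)
    (M : Matrix (Occ n × κ) (Occ n × κ) ℂ) : (ampliation E M).trace = M.trace := by
  simp only [Matrix.trace, Matrix.diag, Fintype.sum_prod_type]
  rw [Finset.sum_comm]
  conv_rhs => rw [Finset.sum_comm]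
  exact Finset.sum_congr rfl fun u _ => hE (block M u u)

lemma ampliation_smul (E : Op n →ₗ[ℂ] Op n) (a : ℂ) (M : Matrix (Occ n × κ) (Occ n × κ) ℂ) :
    ampliation E (a • M) = a • ampliation E M :=
  ext_block fun u v => by simp [block_smul, block_ampliation]

variable [Fintype κ]

lemma block_one_kronecker_mul (Y : Matrix κ κ ℂ) (M : Matrix (Occ n × κ) (Occ n × κ) ℂ)
    (u v : κ) : block (((1 : Op n) ⊗ₖ Y) * M) u v = ∑ w, Y u w • block M w v := by
  ext s t
  simp [block, Matrix.mul_apply, Fintype.sum_prod_type_right, Matrix.one_apply, Matrix.sum_apply,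
    ite_mul]

lemma block_mul_one_kronecker (Y : Matrix κ κ ℂ) (M : Matrix (Occ n × κ) (Occ n × κ) ℂ)
    (u v : κ) : block (M * ((1 : Op n) ⊗ₖ Y)) u v = ∑ w, Y w v • block M u w := by
  ext s t
  simp [block, Matrix.mul_apply, Fintype.sum_prod_type_right, Matrix.one_apply, Matrix.sum_apply,
    ite_mul, mul_comm]

/-- An operator on the second factor only forms linear combinations of blocks, and these pass
through the linear map. -/
lemma one_kronecker_mul_ampliation (E : Op n →ₗ[ℂ] Op n) (Y : Matrix κ κ ℂ)
    (M : Matrix (Occ n × κ) (Occ n × κ) ℂ) :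
    ((1 : Op n) ⊗ₖ Y) * ampliation E M = ampliation E (((1 : Op n) ⊗ₖ Y) * M) :=
  ext_block fun u v => by simp [block_one_kronecker_mul, block_ampliation]

lemma ampliation_mul_one_kronecker (E : Op n →ₗ[ℂ] Op n) (Y : Matrix κ κ ℂ)
    (M : Matrix (Occ n × κ) (Occ n × κ) ℂ) :
    ampliation E M * ((1 : Op n) ⊗ₖ Y) = ampliation E (M * ((1 : Op n) ⊗ₖ Y)) :=
  ext_block fun u v => by simp [block_mul_one_kronecker, block_ampliation]

variable [DecidableEq κ]

lemma block_kronecker_one_mul (X : Op n) (M : Matrix (Occ n × κ) (Occ n × κ) ℂ) (u v : κ) :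
    block ((X ⊗ₖ (1 : Matrix κ κ ℂ)) * M) u v = X * block M u v := by
  ext s t
  simp [block, Matrix.mul_apply, Fintype.sum_prod_type, Matrix.one_apply]

lemma block_mul_kronecker_one (X : Op n) (M : Matrix (Occ n × κ) (Occ n × κ) ℂ) (u v : κ) :
    block (M * (X ⊗ₖ (1 : Matrix κ κ ℂ))) u v = block M u v * X := by
  ext s t
  simp [block, Matrix.mul_apply, Fintype.sum_prod_type, Matrix.one_apply]

lemma ampliation_mulLeft (E : Op n →ₗ[ℂ] Op n) (X : Op n)
    (M : Matrix (Occ n × κ) (Occ n × κ) ℂ) :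
    ampliation (LinearMap.mulLeft ℂ X ∘ₗ E) M = (X ⊗ₖ (1 : Matrix κ κ ℂ)) * ampliation E M :=
  ext_block fun u v => by simp [block_kronecker_one_mul, block_ampliation]

lemma ampliation_mulRight (E : Op n →ₗ[ℂ] Op n) (X : Op n)
    (M : Matrix (Occ n × κ) (Occ n × κ) ℂ) :
    ampliation (LinearMap.mulRight ℂ X ∘ₗ E) M = ampliation E M * (X ⊗ₖ (1 : Matrix κ κ ℂ)) :=
  ext_block fun u v => by simp [block_mul_kronecker_one, block_ampliation]

lemma ampliation_comp_mulLeft (E : Op n →ₗ[ℂ] Op n) (X : Op n)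
    (M : Matrix (Occ n × κ) (Occ n × κ) ℂ) :
    ampliation (E ∘ₗ LinearMap.mulLeft ℂ X) M = ampliation E ((X ⊗ₖ (1 : Matrix κ κ ℂ)) * M) :=
  ext_block fun u v => by simp [block_kronecker_one_mul, block_ampliation]

lemma ampliation_comp_mulRight (E : Op n →ₗ[ℂ] Op n) (X : Op n)
    (M : Matrix (Occ n × κ) (Occ n × κ) ℂ) :
    ampliation (E ∘ₗ LinearMap.mulRight ℂ X) M = ampliation E (M * (X ⊗ₖ (1 : Matrix κ κ ℂ))) :=
  ext_block fun u v => by simp [block_mul_kronecker_one, block_ampliation]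

end Ampliation

end

/-! ### The Choi operator: transfer of multiplications and injectivity -/

section

variable {n : ℕ}

/-- The Choi–Jamiołkowski operator as an operator on the tensor product of two Fock spaces. -/
noncomputable def choi (E : Op n →ₗ[ℂ] Op n) : Matrix (Occ n × Occ n) (Occ n × Occ n) ℂ :=
  ampliation E (split n (maxEntangled n))

lemma split_choiState (E : Op n →ₗ[ℂ] Op n) : split n (choiState E) = choi E := by
  change (Matrix.reindexAlgEquiv ℂ ℂ (Fin.appendEquiv n n).symm) _ = _
  rw [Matrix.coe_reindexAlgEquiv, choiState, ← Matrix.reindex_symm (Fin.appendEquiv n n),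
    Equiv.symm_apply_apply]
  rfl

lemma trace_split (X : Op (n + n)) : (split n X).trace = X.trace :=
  Equiv.sum_comp (Fin.appendEquiv n n) X.diag

lemma choi_mulLeft (E : Op n →ₗ[ℂ] Op n) (X : Op n) :
    choi (LinearMap.mulLeft ℂ X ∘ₗ E) = (X ⊗ₖ (1 : Op n)) * choi E :=
  ampliation_mulLeft _ _ _

lemma choi_mulRight (E : Op n →ₗ[ℂ] Op n) (X : Op n) :
    choi (LinearMap.mulRight ℂ X ∘ₗ E) = choi E * (X ⊗ₖ (1 : Op n)) :=
  ampliation_mulRight _ _ _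

lemma kronecker_split (A B : Op n) : A ⊗ₖ B = (A ⊗ₖ (1 : Op n)) * ((1 : Op n) ⊗ₖ B) := by
  rw [← Matrix.mul_kronecker_mul, mul_one, one_mul]

lemma kronecker_split' (A B : Op n) : A ⊗ₖ B = ((1 : Op n) ⊗ₖ B) * (A ⊗ₖ (1 : Op n)) := by
  rw [← Matrix.mul_kronecker_mul, mul_one, one_mul]

/-- The string is removed from the input operator because parity on the output factor need not pass
through `E`; what remains, 1 ⊗ c_p, does. The price is that the transferred operator is P c_p. -/
lemma one_kronecker_mul_maxEntangled (p : Fin n × Fin 2) :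
    ((1 : Op n) ⊗ₖ majorana p) * split n (maxEntangled n) =
      (-Complex.I) • (((parity n * majorana p) ⊗ₖ (1 : Op n)) * split n (maxEntangled n)) := by
  have h := congrArg (split n) (majoranaR_mul_maxEntangled p)
  rw [map_smul, map_mul, map_mul, split_majoranaR, split_majoranaL] at h
  have h2 : (1 : Op n) ⊗ₖ majorana p =
      (parity n ⊗ₖ (1 : Op n)) * (parity n ⊗ₖ majorana p) := by
    rw [← Matrix.mul_kronecker_mul, one_mul, parity_sq]
  rw [h2, mul_assoc, h, mul_smul_comm, ← mul_assoc, ← Matrix.mul_kronecker_mul, one_mul]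

lemma maxEntangled_mul_one_kronecker (p : Fin n × Fin 2) :
    split n (maxEntangled n) * ((1 : Op n) ⊗ₖ majorana p) =
      Complex.I • (split n (maxEntangled n) * ((majorana p * parity n) ⊗ₖ (1 : Op n))) := by
  have h := congrArg (split n) (maxEntangled_mul_majoranaR p)
  rw [map_smul, map_mul, map_mul, split_majoranaR, split_majoranaL] at h
  have h2 : (1 : Op n) ⊗ₖ majorana p =
      (parity n ⊗ₖ majorana p) * (parity n ⊗ₖ (1 : Op n)) := by
    rw [← Matrix.mul_kronecker_mul, mul_one, parity_sq]
  rw [h2, ← mul_assoc, h, smul_mul_assoc, mul_assoc, ← Matrix.mul_kronecker_mul, mul_one]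

lemma majoranaR_mul_choi (E : Op n →ₗ[ℂ] Op n) (p : Fin n × Fin 2) :
    split n (majoranaR p) * choi E = (-Complex.I) • choi (LinearMap.mulLeft ℂ (parity n) ∘ₗ E ∘ₗ
      LinearMap.mulLeft ℂ (parity n * majorana p)) := by
  rw [split_majoranaR, kronecker_split, mul_assoc, choi_mulLeft, choi, choi,
    one_kronecker_mul_ampliation, one_kronecker_mul_maxEntangled, ampliation_smul,
    ampliation_comp_mulLeft, mul_smul_comm]

lemma choi_mul_majoranaR (E : Op n →ₗ[ℂ] Op n) (p : Fin n × Fin 2) :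
    choi E * split n (majoranaR p) = Complex.I • choi (LinearMap.mulRight ℂ (parity n) ∘ₗ E ∘ₗ
      LinearMap.mulRight ℂ (majorana p * parity n)) := by
  rw [split_majoranaR, kronecker_split', ← mul_assoc, choi_mulRight, choi, choi,
    ampliation_mul_one_kronecker, maxEntangled_mul_one_kronecker, ampliation_smul,
    ampliation_comp_mulRight, smul_mul_assoc]

lemma choi_add (E F : Op n →ₗ[ℂ] Op n) : choi (E + F) = choi E + choi F := rfl

lemma choi_smul (a : ℂ) (E : Op n →ₗ[ℂ] Op n) : choi (a • E) = a • choi E := rfl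

lemma choi_sum {ι : Type*} (s : Finset ι) (E : ι → Op n →ₗ[ℂ] Op n) :
    choi (∑ i ∈ s, E i) = ∑ i ∈ s, choi (E i) := by
  classical
  induction s using Finset.induction_on with
  | empty => rfl
  | insert a s ha ih => rw [Finset.sum_insert ha, Finset.sum_insert ha, choi_add, ih]

/-- A nonzero subspace stable under multiplication by all matrices from both sides is everything. -/
lemma submodule_eq_top {Q : Submodule ℂ (Op n)} (hQ : Q ≠ ⊥)
    (hl : ∀ p, ∀ Z ∈ Q, parity n * majorana p * Z ∈ Q)
    (hr : ∀ p, ∀ Z ∈ Q, Z * (parity n * majorana p) ∈ Q) : Q = ⊤ := by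
  let L : Subalgebra ℂ (Op n) :=
    { carrier := {Y | ∀ Z ∈ Q, Y * Z ∈ Q}
      mul_mem' := fun {a b} ha hb Z hZ => by rw [mul_assoc]; exact ha _ (hb Z hZ)
      add_mem' := fun {a b} ha hb Z hZ => by rw [add_mul]; exact Q.add_mem (ha Z hZ) (hb Z hZ)
      algebraMap_mem' := fun r Z hZ => by
        rw [← Algebra.smul_def]; exact Q.smul_mem r hZ }
  let R : Subalgebra ℂ (Op n) :=
    { carrier := {Y | ∀ Z ∈ Q, Z * Y ∈ Q}
      mul_mem' := fun {a b} ha hb Z hZ => by rw [← mul_assoc]; exact hb _ (ha Z hZ)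
      add_mem' := fun {a b} ha hb Z hZ => by rw [mul_add]; exact Q.add_mem (ha Z hZ) (hb Z hZ)
      algebraMap_mem' := fun r Z hZ => by
        rw [← Algebra.commutes, ← Algebra.smul_def]; exact Q.smul_mem r hZ }
  have hL : L = ⊤ := eq_top_of_parity_mul_majorana_mem fun p Z hZ => hl p Z hZ
  have hR : R = ⊤ := eq_top_of_parity_mul_majorana_mem fun p Z hZ => hr p Z hZ
  obtain ⟨Z, hZ, hZ0⟩ := Q.ne_bot_iff.mp hQ
  obtain ⟨a, b, hab⟩ : ∃ a b, Z a b ≠ 0 := by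
    by_contra! h
    exact hZ0 (Matrix.ext h)
  rw [eq_top_iff]
  intro X _
  rw [Matrix.matrix_eq_sum_single X]
  refine Q.sum_mem fun i _ => Q.sum_mem fun j _ => ?_
  have h1 : (Matrix.single i a (1 : ℂ) : Op n) ∈ L := by simp [hL]
  have h2 : (Matrix.single b j (1 : ℂ) : Op n) ∈ R := by simp [hR]
  have h3 := Q.smul_mem ((Z a b)⁻¹ * X i j) (h2 _ (h1 Z hZ))
  rw [Matrix.single_mul_mul_single, Matrix.smul_single] at h3
  rwa [smul_eq_mul, one_mul, mul_one, mul_right_comm, inv_mul_cancel₀ hab, one_mul] at h3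

/-- The Choi operator records the map on the blocks of the maximally entangled state. Acting with 1
⊗ c_p recombines these blocks and equals multiplication by P c_p up to a scalar, so their span is a
nonzero two-sided ideal of a full matrix algebra, hence everything. -/
lemma choi_injective (h0 : maxEntangled n ≠ 0) {E F : Op n →ₗ[ℂ] Op n} (h : choi E = choi F) :
    E = F := by
  set M := split n (maxEntangled n) with hM
  have hM0 : M ≠ 0 := by
    rw [hM]
    exact (map_ne_zero_iff _ (split n).injective).mpr h0
  let Q : Submodule ℂ (Op n) := Submodule.span ℂ (Set.range fun x : Occ n × Occ n => block M x.1 x.2)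
  have hmem : ∀ u v, block M u v ∈ Q := fun u v => Submodule.subset_span ⟨(u, v), rfl⟩
  have hQ : Q ≠ ⊥ := by
    intro hb
    apply hM0
    refine ext_block fun u v => ?_
    have := hmem u v
    rw [hb, Submodule.mem_bot] at this
    rw [this]
    rfl
  have hl : ∀ p, ∀ Z ∈ Q, parity n * majorana p * Z ∈ Q := by
    intro p Z hZ
    induction hZ using Submodule.span_induction with
    | mem x hx =>
      obtain ⟨⟨u, v⟩, rfl⟩ := hx
      have h1 := congrArg (fun A => Complex.I • block A u v) (one_kronecker_mul_maxEntangled p)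
      simp only [← hM, block_smul, block_kronecker_one_mul, block_one_kronecker_mul, smul_smul] at h1
      rw [mul_neg, Complex.I_mul_I, neg_neg, one_smul] at h1
      rw [← h1]
      exact Q.smul_mem _ (Q.sum_mem fun w _ => Q.smul_mem _ (hmem _ _))
    | zero => simp
    | add x y _ _ hx hy => rw [mul_add]; exact Q.add_mem hx hy
    | smul a x _ hx => rw [mul_smul_comm]; exact Q.smul_mem _ hx
  have hr : ∀ p, ∀ Z ∈ Q, Z * (parity n * majorana p) ∈ Q := by
    intro p Z hZ
    induction hZ using Submodule.span_induction with
    | mem x hx =>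
      obtain ⟨⟨u, v⟩, rfl⟩ := hx
      have h1 := congrArg (fun A => Complex.I • block A u v) (maxEntangled_mul_one_kronecker p)
      simp only [← hM, block_smul, block_mul_kronecker_one, block_mul_one_kronecker, smul_smul] at h1
      rw [Complex.I_mul_I, neg_one_smul, ← mul_neg, ← parity_mul_majorana] at h1
      rw [← h1]
      exact Q.smul_mem _ (Q.sum_mem fun w _ => Q.smul_mem _ (hmem _ _))
    | zero => simp
    | add x y _ _ hx hy => rw [add_mul]; exact Q.add_mem hx hy
    | smul a x _ hx => rw [smul_mul_assoc]; exact Q.smul_mem _ hx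
  have htop := submodule_eq_top hQ hl hr
  refine LinearMap.ext_on (s := Set.range fun x : Occ n × Occ n => block M x.1 x.2) htop ?_
  rintro _ ⟨⟨u, v⟩, rfl⟩
  exact congrArg (fun A => block A u v) h

/-- A product of two input operators carries P² = 1 on the output factor, so trace preservation
reduces the expectation value to that of the maximally entangled state. -/
lemma kappa_choiState_natAdd {E : Op n →ₗ[ℂ] Op n} (hE : ∀ X, (E X).trace = X.trace)
    (p q : Fin n × Fin 2) :
    kappa (choiState E) (Fin.natAdd n p.1, p.2) (Fin.natAdd n q.1, q.2) = 0 := by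
  have h1 : ∀ p q : Fin n × Fin 2, (choiState E * (majoranaR p * majoranaR q)).trace =
      (maxEntangled n * (majoranaR p * majoranaR q)).trace := by
    intro p q
    rw [← trace_split, ← trace_split (maxEntangled n * _), map_mul, map_mul (split n) (maxEntangled n),
      split_choiState, map_mul, split_majoranaR, split_majoranaR, ← Matrix.mul_kronecker_mul,
      parity_sq, choi, ampliation_mul_one_kronecker, trace_ampliation hE]
  rw [kappa, Matrix.of_apply, mul_sub, Matrix.trace_sub, h1 p q, h1 q p, trace_maxEntangled_comm,
    sub_self, mul_zero]

lemma maxEntangled_ne_zero {E : Op n →ₗ[ℂ] Op n} (h : (choiState E).trace = 1) :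
    maxEntangled n ≠ 0 := by
  intro h0
  have : choi E = 0 := by
    have := ampliation_smul E 0 (split n (maxEntangled n))
    rw [h0, map_zero, smul_zero, zero_smul] at this
    rw [choi, h0, map_zero, this]
  rw [← trace_split, split_choiState, this] at h
  simp at h

end

/-! ### Elimination in the Wick relations and the range of maps with pure output -/

section

section Elimination
variable {A : Type*} [Ring A] [Algebra ℂ A]

/-- Writing {ρ, R} = 2ρR - [ρ, R] and substituting the second relation removes Rρ. Only Lρ then
remains as a left multiplication, with coefficient 1 + α + ββᵀ. -/
lemma elimination {ρ : A} {L R : Fin 2 → A} {α β : Matrix (Fin 2) (Fin 2) ℂ}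
    (h1 : ∀ a, ρ * L a - L a * ρ =
      ∑ b, α a b • (ρ * L b + L b * ρ) + ∑ b, β a b • (ρ * R b + R b * ρ))
    (h2 : ∀ a, ρ * R a - R a * ρ = ∑ b, -β b a • (ρ * L b + L b * ρ)) (a : Fin 2) :
    ∑ c, (1 + α + β * βᵀ) a c • (L c * ρ) =
      ∑ c, (1 - α - β * βᵀ) a c • (ρ * L c) + ∑ b, (-2 * β a b) • (ρ * R b) := by
  have h20 := h2 0
  have h21 := h2 1
  have h := h1 a
  simp only [Fin.sum_univ_two, Matrix.add_apply, Matrix.sub_apply, Matrix.mul_apply,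
    Matrix.transpose_apply] at h h20 h21 ⊢
  obtain rfl | rfl : a = 0 ∨ a = 1 := by fin_cases a <;> simp
  · simp only [Matrix.one_apply_eq, Matrix.one_apply_ne zero_ne_one]
    linear_combination (norm := module) (β 0 0) • h20 + (β 0 1) • h21 - h
  · simp only [Matrix.one_apply_eq, Matrix.one_apply_ne one_ne_zero]
    linear_combination (norm := module) (β 1 0) • h20 + (β 1 1) • h21 - h

/-- Contracting with B inverts the first relation by orthogonality. Sums and differences with the
second then separate left from right multiplications. -/
lemma intertwine_of_comm {ρ : A} {L R : Fin 2 → A} {B : Matrix (Fin 2) (Fin 2) ℂ}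
    (hB : Bᵀ * B = 1)
    (h1 : ∀ a, ρ * L a - L a * ρ = ∑ b, (-Complex.I * B a b) • (ρ * R b + R b * ρ))
    (h2 : ∀ a, ρ * R a - R a * ρ = ∑ b, (Complex.I * B b a) • (ρ * L b + L b * ρ)) (r : Fin 2) :
    (∑ b, B b r • (L b * ρ) = Complex.I • (R r * ρ)) ∧
      ∑ b, B b r • (ρ * L b) = (-Complex.I) • (ρ * R r) := by
  have e1 : ∑ b, B b r • (ρ * L b - L b * ρ) = (-Complex.I) • (ρ * R r + R r * ρ) := by
    have h3 : ∀ c, ∑ b, B b r * B b c = if r = c then 1 else 0 := by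
      intro c
      have := congrFun (congrFun hB r) c
      rwa [Matrix.mul_apply, Matrix.one_apply] at this
    simp only [h1, Finset.smul_sum, smul_smul]
    rw [Finset.sum_comm]
    have h4 : ∀ c b, B b r * (-Complex.I * B b c) = -Complex.I * (B b r * B b c) :=
      fun c b => by ring
    simp only [h4, ← Finset.sum_smul, ← Finset.mul_sum, h3, mul_ite, mul_one, mul_zero,
      ite_smul, zero_smul, Finset.sum_ite_eq, Finset.mem_univ, if_true]
  have e2 : ∑ b, B b r • (ρ * L b + L b * ρ) = (-Complex.I) • (ρ * R r - R r * ρ) := by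
    simp only [h2, Finset.smul_sum, smul_smul, ← mul_assoc]
    simp
  have e3 : ∀ x y : A, x = (2⁻¹ : ℂ) • ((x + y) - (y - x)) := fun x y => by
    rw [show x + y - (y - x) = (2 : ℂ) • x by rw [two_smul]; abel, smul_smul]; norm_num
  have e4 : ∀ x y : A, y = (2⁻¹ : ℂ) • ((x + y) + (y - x)) := fun x y => by
    rw [show x + y + (y - x) = (2 : ℂ) • y by rw [two_smul]; abel, smul_smul]; norm_num
  have e5 : ∑ b, B b r • (ρ * L b) - ∑ b, B b r • (L b * ρ) =
      (-Complex.I) • (ρ * R r + R r * ρ) := by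
    rw [← e1, ← Finset.sum_sub_distrib]
    simp only [smul_sub]
  have e6 : ∑ b, B b r • (L b * ρ) + ∑ b, B b r • (ρ * L b) =
      (-Complex.I) • (ρ * R r - R r * ρ) := by
    rw [← e2, ← Finset.sum_add_distrib]
    simp only [smul_add, add_comm]
  constructor
  · rw [e3 (∑ b, B b r • (L b * ρ)) (∑ b, B b r • (ρ * L b)), e5, e6]
    module
  · rw [e4 (∑ b, B b r • (L b * ρ)) (∑ b, B b r • (ρ * L b)), e5, e6]
    module

end Elimination

section Positivity
variable {n : ℕ}

/-- Complete positivity is applied to the rank-one operator of the pair (Ψ, χ) in Fock space ⊗ ℂ².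
One diagonal block of the image is `proj Φ`; in a positive semidefinite matrix its kernel also
annihilates the adjacent off-diagonal block, so the adjoint block has range in the line of Φ. -/
lemma proj_mul_map_vecMulVec {E : Op n →ₗ[ℂ] Op n} (hE : IsCompletelyPositive E)
    {Ψ Φ : Occ n → ℂ} (hΦ : star Φ ⬝ᵥ Φ = 1) (h : E (proj Ψ) = proj Φ) (χ : Occ n → ℂ) :
    proj Φ * E (Matrix.vecMulVec Ψ (star χ)) = E (Matrix.vecMulVec Ψ (star χ)) := by
  let v : Occ n × Fin 2 → ℂ := fun x => if x.2 = 0 then Ψ x.1 else χ x.1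
  let M := Matrix.vecMulVec v (star v)
  have hA : (ampliation E M).PosSemidef := hE 2 M (Matrix.posSemidef_vecMulVec_self_star v)
  have h00 : block (ampliation E M) 0 0 = proj Φ := by
    rw [block_ampliation, ← h]
    rfl
  have h01 : block (ampliation E M) 0 1 = E (Matrix.vecMulVec Ψ (star χ)) := by
    rw [block_ampliation]
    rfl
  have h10 : (block (ampliation E M) 1 0)ᴴ = block (ampliation E M) 0 1 := by
    conv_rhs => rw [← hA.isHermitian.eq]
    rfl
  have hmv : ∀ (y : Occ n → ℂ) (u : Fin 2) (s : Occ n),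
      (ampliation E M *ᵥ fun x => if x.2 = 0 then y x.1 else 0) (s, u) =
        (block (ampliation E M) u 0 *ᵥ y) s := by
    intro y u s
    simp [Matrix.mulVec, dotProduct, Fintype.sum_prod_type, block]
  have key : ∀ y, proj Φ *ᵥ y = 0 → block (ampliation E M) 1 0 *ᵥ y = 0 := by
    intro y hy
    have h1 : star (fun x : Occ n × Fin 2 => if x.2 = 0 then y x.1 else 0) ⬝ᵥ
        (ampliation E M *ᵥ fun x => if x.2 = 0 then y x.1 else 0) = 0 := by
      rw [dotProduct, Fintype.sum_prod_type]
      refine Finset.sum_eq_zero fun s _ => ?_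
      simp only [Fin.sum_univ_two, hmv, h00, hy]
      simp
    have h2 := (hA.dotProduct_mulVec_zero_iff _).mp h1
    ext s
    rw [← hmv, h2]
    rfl
  have hpp : proj Φ * proj Φ = proj Φ := by
    rw [mul_proj, proj_mulVec_self hΦ]
    rfl
  have h2 : block (ampliation E M) 1 0 * (1 - proj Φ) = 0 := by
    apply Matrix.ext_of_mulVec_single
    intro s
    rw [← Matrix.mulVec_mulVec, key, Matrix.zero_mulVec]
    rw [Matrix.mulVec_mulVec, mul_sub, mul_one, hpp, sub_self, Matrix.zero_mulVec]
  have h3 := congrArg Matrix.conjTranspose h2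
  rw [Matrix.conjTranspose_mul, h10, h01, Matrix.conjTranspose_sub, Matrix.conjTranspose_one,
    proj_conjTranspose, Matrix.conjTranspose_zero, sub_mul, one_mul, sub_eq_zero] at h3
  exact h3.symm

end Positivity

end

/-! ### The covariance blocks of a party and the resulting rotation -/

section

variable {n : ℕ}

lemma covariance_eq {N : ℕ} (ρ : Op N) (p q : Fin N × Fin 2) :
    covariance ρ p q = Complex.I * kappa ρ p q := by
  simp only [covariance, kappa, Matrix.of_apply]
  have : -(1 / (2 * Complex.I)) = Complex.I * 2⁻¹ := by
    field_simp
    rw [Complex.I_sq]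
  rw [this, mul_assoc]

lemma kappa_swap {N : ℕ} (ρ : Op N) (p q : Fin N × Fin 2) : kappa ρ q p = -kappa ρ p q := by
  simp only [kappa, Matrix.of_apply]
  rw [← neg_sub, mul_neg, Matrix.trace_neg, mul_neg]

lemma star_kappa {N : ℕ} {ρ : Op N} (h : ρᴴ = ρ) (p q : Fin N × Fin 2) :
    star (kappa ρ p q) = -kappa ρ p q := by
  simp only [kappa, Matrix.of_apply, star_mul']
  rw [← Matrix.trace_conjTranspose, Matrix.conjTranspose_mul, Matrix.conjTranspose_sub,
    Matrix.conjTranspose_mul, Matrix.conjTranspose_mul, majorana_conjTranspose,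
    majorana_conjTranspose, h, Matrix.trace_mul_comm, ← neg_sub, mul_neg, Matrix.trace_neg]
  simp

lemma party_castAdd (i : Fin n) : party (Fin.castAdd n i) = i := by simp [party]

lemma party_natAdd (i : Fin n) : party (Fin.natAdd n i) = i := by
  simp [party, -Fin.natAdd_eq_addNat]

lemma sum_eq_sum_party {A : Type*} [AddCommMonoid A] {f : Fin (n + n) × Fin 2 → A} (i : Fin n)
    (h : ∀ q, party q.1 ≠ i → f q = 0) :
    ∑ q, f q = ∑ b, f (Fin.castAdd n i, b) + ∑ b, f (Fin.natAdd n i, b) := by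
  rw [Fintype.sum_prod_type, Fin.sum_univ_add, Finset.sum_eq_single i, Finset.sum_eq_single i]
  · intro j _ hj
    exact Finset.sum_eq_zero fun b _ => h _ (by rwa [party_natAdd])
  · simp
  · intro j _ hj
    exact Finset.sum_eq_zero fun b _ => h _ (by rwa [party_castAdd])
  · simp

variable {E : Op n →ₗ[ℂ] Op n}

lemma IsGaussianSeparable.kappa_eq_zero (hE : IsGaussianSeparable E) {p q : Fin (n + n) × Fin 2}
    (h : party p.1 ≠ party q.1) : kappa (choiState E) p q = 0 := by
  have := hE.directSum p q h
  rw [covariance_eq] at this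
  exact (mul_eq_zero.mp this).resolve_left Complex.I_ne_zero

/-- The block of `kappa` between the output modes of a party. -/
noncomputable def kappaOut (E : Op n →ₗ[ℂ] Op n) (i : Fin n) : Matrix (Fin 2) (Fin 2) ℂ :=
  Matrix.of fun a b => kappa (choiState E) (Fin.castAdd n i, a) (Fin.castAdd n i, b)

/-- The block of `kappa` between the output and the input modes of a party. -/
noncomputable def kappaMix (E : Op n →ₗ[ℂ] Op n) (i : Fin n) : Matrix (Fin 2) (Fin 2) ℂ :=
  Matrix.of fun a b => kappa (choiState E) (Fin.castAdd n i, a) (Fin.natAdd n i, b)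

lemma IsGaussianSeparable.comm_majoranaL (hE : IsGaussianSeparable E) (i : Fin n) (a : Fin 2) :
    choi E * split n (majoranaL (i, a)) - split n (majoranaL (i, a)) * choi E =
      ∑ b, kappaOut E i a b •
        (choi E * split n (majoranaL (i, b)) + split n (majoranaL (i, b)) * choi E) +
      ∑ b, kappaMix E i a b •
        (choi E * split n (majoranaR (i, b)) + split n (majoranaR (i, b)) * choi E) := by
  have h := hE.gaussian.wickRelation.comm (Fin.castAdd n i, a)
  rw [sum_eq_sum_party i] at h
  · have h2 := congrArg (split n) h
    simp only [map_sub, map_add, map_mul, map_sum, map_smul, split_choiState] at h2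
    exact h2
  · intro q hq
    rw [hE.kappa_eq_zero, zero_smul]
    rw [party_castAdd]
    exact hq.symm

lemma IsGaussianSeparable.comm_majoranaR (hE : IsGaussianSeparable E) (i : Fin n) (a : Fin 2) :
    choi E * split n (majoranaR (i, a)) - split n (majoranaR (i, a)) * choi E =
      ∑ b, -kappaMix E i b a •
        (choi E * split n (majoranaL (i, b)) + split n (majoranaL (i, b)) * choi E) := by
  have h := hE.gaussian.wickRelation.comm (Fin.natAdd n i, a)
  rw [sum_eq_sum_party i] at h
  · have h0 : ∀ b, kappa (choiState E) (Fin.natAdd n i, a) (Fin.natAdd n i, b) = 0 :=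
      fun b => kappa_choiState_natAdd hE.tracePreserving (i, a) (i, b)
    have h1 : ∀ b, kappa (choiState E) (Fin.natAdd n i, a) (Fin.castAdd n i, b) =
      -kappaMix E i b a := fun b => kappa_swap _ _ _
    simp only [h0, h1, zero_smul, Finset.sum_const_zero, add_zero] at h
    have h2 := congrArg (split n) h
    simp only [map_sub, map_add, map_mul, map_sum, map_smul, split_choiState] at h2
    exact h2
  · intro q hq
    rw [hE.kappa_eq_zero, zero_smul]
    rw [party_natAdd]
    exact hq.symm

lemma majoranaL_mul_choi (p : Fin n × Fin 2) :
    split n (majoranaL p) * choi E = choi (LinearMap.mulLeft ℂ (majorana p) ∘ₗ E) := by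
  rw [split_majoranaL, choi_mulLeft]

lemma choi_mul_majoranaL (p : Fin n × Fin 2) :
    choi E * split n (majoranaL p) = choi (LinearMap.mulRight ℂ (majorana p) ∘ₗ E) := by
  rw [split_majoranaL, choi_mulRight]

/-- The map `E` with a pure fully entangled output forces `1 + α + β βᵀ = 0`. -/
lemma IsGaussianSeparable.one_add_kappa_eq_zero (hn : 2 ≤ n) (hE : IsGaussianSeparable E)
    {Ψ Φ : Occ n → ℂ} (hΦ : IsPureState Φ) (hent : FullyEntangled Φ)
    (hmap : E (proj Ψ) = proj Φ) (i : Fin n) :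
    1 + kappaOut E i + kappaMix E i * (kappaMix E i)ᵀ = 0 := by
  ext a c
  by_contra hne
  have hM : maxEntangled n ≠ 0 := maxEntangled_ne_zero hE.gaussian.wickRelation.trace_eq_one
  have h := elimination (hE.comm_majoranaL i) (hE.comm_majoranaR i) a
  simp only [majoranaL_mul_choi, choi_mul_majoranaL, choi_mul_majoranaR, ← choi_smul, ← choi_sum,
    ← choi_add] at h
  have h2 := LinearMap.congr_fun (choi_injective hM h) (proj Ψ)
  simp only [LinearMap.sum_apply, LinearMap.add_apply, LinearMap.smul_apply, LinearMap.comp_apply,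
    LinearMap.mulLeft_apply, LinearMap.mulRight_apply, hmap] at h2
  have hpp : proj Φ * proj Φ = proj Φ := by
    rw [mul_proj, proj_mulVec_self hΦ.norm_eq_one]
    rfl
  have h3 : ∀ Y : Op n, proj Φ * E (proj Ψ * Y) = E (proj Ψ * Y) := by
    intro Y
    have : proj Ψ * Y = Matrix.vecMulVec Ψ (star (star (star Ψ ᵥ* Y))) := by
      rw [star_star, proj, Matrix.vecMulVec_mul]
    rw [this]
    exact proj_mul_map_vecMulVec hE.completelyPositive hΦ.norm_eq_one hmap _
  set x := (1 + kappaOut E i + kappaMix E i * (kappaMix E i)ᵀ) a with hx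
  set Z := ∑ b, x b • majorana (i, b) with hZ
  have h4 : ∑ b, x b • (majorana (i, b) * proj Φ) = Z * proj Φ := by
    simp only [hZ, Finset.sum_mul, smul_mul_assoc]
  -- Each term on the right of `h2` either begins with `proj Φ` or contains `E` of something of the
  -- form `proj Ψ * Y`, so `proj Φ` fixes it from the left. Hence `Z` maps Φ into its own line.
  have h5 : proj Φ * (Z * proj Φ) = Z * proj Φ := by
    rw [← h4, h2]
    have h3' : ∀ Y Y' : Op n, proj Φ * E (proj Ψ * Y * Y') = E (proj Ψ * Y * Y') := fun Y Y' => by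
      rw [mul_assoc, h3]
    simp only [mul_add, Finset.mul_sum, mul_smul_comm, ← mul_assoc, hpp, h3']
  have h6 : Z *ᵥ Φ = (star Φ ⬝ᵥ (Z *ᵥ Φ)) • Φ := by
    have h7 := congrArg (· *ᵥ Φ) h5
    simp only [← Matrix.mulVec_mulVec, proj_mulVec_self hΦ.norm_eq_one] at h7
    rw [proj, Matrix.vecMulVec_mulVec] at h7
    simpa using h7.symm
  refine hent {i} (Finset.singleton_nonempty i) ?_
    (factorizesAcross_of_eigenvector hΦ (x := x) ?_ h6)
  · rw [← Finset.card_pos, Finset.card_compl, Finset.card_singleton, Fintype.card_fin]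
    omega
  · intro h0
    exact hne (congrFun h0 c)

/-- The antisymmetric and symmetric parts of the equation vanish separately. -/
lemma eq_zero_of_one_add_add_mul_transpose {α β : Matrix (Fin 2) (Fin 2) ℂ} (hα : αᵀ = -α)
    (h : 1 + α + β * βᵀ = 0) : α = 0 ∧ β * βᵀ = -1 := by
  have h2 : 1 - α + β * βᵀ = 0 := by
    have := congrArg Matrix.transpose h
    simpa [Matrix.transpose_mul, hα, ← sub_eq_add_neg] using this
  have h3 : α = 0 := by
    have : (2 : ℂ) • α = 0 := by
      linear_combination (norm := module) h - h2
    exact (smul_eq_zero.mp this).resolve_left two_ne_zero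
  refine ⟨h3, ?_⟩
  rw [h3, add_zero] at h
  exact (neg_eq_of_add_eq_zero_right h).symm

/-- A Gaussian separable map with a pure fully entangled output on a pure input rotates the Majorana
operators of each party. -/
lemma IsGaussianSeparable.exists_orthogonal (hn : 2 ≤ n) (hE : IsGaussianSeparable E)
    {Ψ Φ : Occ n → ℂ} (hΦ : IsPureState Φ) (hent : FullyEntangled Φ)
    (hmap : E (proj Ψ) = proj Φ) (i : Fin n) :
    ∃ B ∈ Matrix.orthogonalGroup (Fin 2) ℝ, ∀ r X,
      (∑ b, (B b r : ℂ) • majorana (i, b)) * E X =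
        parity n * E (parity n * majorana (i, r) * X) ∧
      E X * (∑ b, (B b r : ℂ) • majorana (i, b)) =
        E (X * (majorana (i, r) * parity n)) * parity n := by
  have hM : maxEntangled n ≠ 0 := maxEntangled_ne_zero hE.gaussian.wickRelation.trace_eq_one
  have hanti : (kappaOut E i)ᵀ = -kappaOut E i := by
    ext a b
    exact kappa_swap _ _ _
  obtain ⟨h0, h1⟩ := eq_zero_of_one_add_add_mul_transpose hanti
    (hE.one_add_kappa_eq_zero hn hΦ hent hmap i)
  -- Hermiticity of the Choi state makes `kappa` purely imaginary, so taking real parts loses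
  -- nothing, and ββᵀ = -1 becomes BBᵀ = 1.
  set B : Matrix (Fin 2) (Fin 2) ℝ := Matrix.of fun a b => (Complex.I * kappaMix E i a b).re with hB
  have hBc : ∀ a b, (B a b : ℂ) = Complex.I * kappaMix E i a b := by
    intro a b
    refine Complex.conj_eq_iff_re.mp ?_
    rw [map_mul, Complex.conj_I]
    have := star_kappa hE.gaussian.wickRelation.isHermitian (Fin.castAdd n i, a) (Fin.natAdd n i, b)
    rw [RCLike.star_def] at this
    simp only [kappaMix, Matrix.of_apply, this]
    ring
  have hmix : ∀ a b, kappaMix E i a b = -Complex.I * (B a b : ℂ) := by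
    intro a b
    rw [hBc, ← mul_assoc, neg_mul, Complex.I_mul_I, neg_neg, one_mul]
  have hBB : B * Bᵀ = 1 := by
    ext a c
    have h2 := congrFun (congrFun h1 a) c
    simp only [Matrix.mul_apply, Matrix.transpose_apply, hmix, Matrix.neg_apply] at h2 ⊢
    have h3 : ((∑ b, B a b * B c b : ℝ) : ℂ) = ((1 : Matrix (Fin 2) (Fin 2) ℝ) a c : ℂ) := by
      have h4 : ∀ b, -Complex.I * (B a b : ℂ) * (-Complex.I * (B c b : ℂ)) =
          -((B a b : ℂ) * (B c b : ℂ)) := fun b => by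
        linear_combination ((B a b : ℂ) * (B c b : ℂ)) * Complex.I_mul_I
      simp only [h4, Finset.sum_neg_distrib, neg_inj] at h2
      push_cast
      rw [h2]
      simp only [Matrix.one_apply]
      split_ifs <;> simp
    exact_mod_cast h3
  have hBB' : Bᵀ * B = 1 := mul_eq_one_comm.mp hBB
  refine ⟨B, (Matrix.mem_orthogonalGroup_iff (Fin 2) ℝ).mpr hBB, fun r X => ?_⟩
  have hBBc : (B.map (Complex.ofRealHom))ᵀ * B.map (Complex.ofRealHom) = 1 := by
    rw [← Matrix.transpose_map, ← Matrix.map_mul, hBB']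
    simp
  have e1 := hE.comm_majoranaL i
  have e2 := hE.comm_majoranaR i
  simp only [h0, Matrix.zero_apply, zero_smul, Finset.sum_const_zero, zero_add, hmix, neg_mul, neg_neg]
    at e1 e2
  simp only [← neg_mul] at e1
  obtain ⟨e3, e4⟩ := intertwine_of_comm (B := B.map (Complex.ofRealHom)) hBBc e1 e2 r
  simp only [majoranaL_mul_choi, choi_mul_majoranaL, choi_mul_majoranaR, majoranaR_mul_choi,
    ← choi_smul, ← choi_sum] at e3 e4
  have e5 := LinearMap.congr_fun (choi_injective hM e3) X
  have e6 := LinearMap.congr_fun (choi_injective hM e4) X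
  simp only [LinearMap.sum_apply, LinearMap.smul_apply, LinearMap.comp_apply,
    LinearMap.mulLeft_apply, LinearMap.mulRight_apply, Matrix.map_apply, Complex.ofRealHom_eq_coe,
    smul_smul, mul_neg, neg_mul, Complex.I_mul_I, neg_neg, one_smul] at e5 e6
  refine ⟨?_, ?_⟩
  · rw [← e5]
    simp only [Finset.sum_mul, smul_mul_assoc]
  · rw [← e6]
    simp only [Finset.mul_sum, mul_smul_comm]

end

/-! ### Local unitaries implementing orthogonal transformations of one mode -/

section

variable {n : ℕ}

/-- The pair (x, y) is a complex square root of c + i s, of modulus one because the square has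
modulus one. -/
lemma exists_half_angle {c s : ℝ} (h : c * c + s * s = 1) :
    ∃ x y : ℝ, x * x + y * y = 1 ∧ x * x - y * y = c ∧ 2 * (x * y) = s := by
  obtain ⟨z, hz⟩ := IsAlgClosed.exists_pow_nat_eq (⟨c, s⟩ : ℂ) (n := 2) (by norm_num)
  rw [sq] at hz
  have hre : z.re * z.re - z.im * z.im = c := by simpa using congrArg Complex.re hz
  have him : z.re * z.im + z.im * z.re = s := by simpa using congrArg Complex.im hz
  refine ⟨z.re, z.im, ?_, hre, by linarith⟩
  have h1 : (z.re * z.re + z.im * z.im) ^ 2 = 1 := by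
    rw [← h, ← hre, ← him]; ring
  have h2 : 0 ≤ z.re * z.re + z.im * z.im :=
    add_nonneg (mul_self_nonneg _) (mul_self_nonneg _)
  exact (pow_eq_one_iff_of_nonneg h2 two_ne_zero).mp h1

/-- The sign ε is the parity of `U`. Inverting the relation by orthogonality of `B` shows that the
Majorana operators are transformed by εB, which is again orthogonal. -/
lemma isLocalUnitary_of_intertwine {i : Fin n} {U : Op n} {B : Matrix (Fin 2) (Fin 2) ℝ}
    (hB : B ∈ Matrix.orthogonalGroup (Fin 2) ℝ) {ε : ℝ} (hε : ε = 1 ∨ ε = -1)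
    (hU : U ∈ Matrix.unitaryGroup (Occ n) ℂ) (hloc : U ∈ modeAlgebra {i})
    (hP : U * parity n = (ε : ℂ) • (parity n * U))
    (hc : ∀ r, U * majorana (i, r) = (ε : ℂ) • ((∑ b, (B b r : ℂ) • majorana (i, b)) * U)) :
    IsLocalUnitary i U := by
  have hε2 : ε * ε = 1 := by rcases hε with rfl | rfl <;> norm_num
  have hBB := (Matrix.mem_orthogonalGroup_iff (Fin 2) ℝ).mp hB
  have hUU : Uᴴ * U = 1 := (Matrix.mem_unitaryGroup_iff').mp hU
  refine ⟨hU, hloc, ?_, ε • B, ?_, fun a => ?_⟩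
  · rcases hε with rfl | rfl
    · left; simpa using hP
    · right; simpa using hP
  · rw [Matrix.mem_orthogonalGroup_iff]
    change (ε • B) * (ε • B)ᵀ = 1
    rw [Matrix.transpose_smul, smul_mul_smul_comm, hε2, one_smul]
    exact hBB
  · have h1 : ∀ r, majorana (i, r) =
        (ε : ℂ) • ∑ b, (B b r : ℂ) • (Uᴴ * majorana (i, b) * U) := by
      intro r
      rw [← one_mul (majorana (i, r)), ← hUU, mul_assoc, hc]
      simp only [mul_smul_comm, Finset.sum_mul, Finset.mul_sum, smul_mul_assoc, mul_assoc]
    have h2 : ∀ b, ∑ r, (((ε • B) a r : ℝ) : ℂ) * (ε * (B b r : ℂ)) = if a = b then 1 else 0 := by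
      intro b
      have h3 := congrFun (congrFun hBB a) b
      rw [Matrix.mul_apply, Matrix.one_apply] at h3
      have h4 : ∑ r, (ε • B) a r * (ε * B b r) = if a = b then 1 else 0 := by
        rw [← h3]
        refine Finset.sum_congr rfl fun r _ => ?_
        change ε * B a r * (ε * B b r) = B a r * B b r
        linear_combination (B a r * B b r) * hε2
      have h5 := congrArg Complex.ofReal h4
      rw [Complex.ofReal_sum] at h5
      simp only [Complex.ofReal_mul] at h5
      rw [h5]
      split_ifs <;> simp
    conv_rhs =>
      enter [2, b]
      rw [h1 b]
    simp only [Finset.smul_sum, smul_smul]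
    rw [Finset.sum_comm]
    simp only [← Finset.sum_smul, h2]
    simp

/-- Every orthogonal transformation of the Majorana operators of a mode is implemented by a local
unitary. -/
lemma exists_localUnitary (i : Fin n) {B : Matrix (Fin 2) (Fin 2) ℝ}
    (hB : B ∈ Matrix.orthogonalGroup (Fin 2) ℝ) :
    ∃ U : Op n, IsLocalUnitary i U ∧ ∀ r, U * (parity n * majorana (i, r)) =
      parity n * (∑ b, (B b r : ℂ) • majorana (i, b)) * U := by
  -- The same ε appears when `U` passes P and when it passes c_r, so it cancels for the product P
  -- c_r.
  suffices h : ∃ U : Op n, ∃ ε : ℝ, (ε = 1 ∨ ε = -1) ∧ U ∈ Matrix.unitaryGroup (Occ n) ℂ ∧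
      U ∈ modeAlgebra {i} ∧ U * parity n = (ε : ℂ) • (parity n * U) ∧
      ∀ r, U * majorana (i, r) = (ε : ℂ) • ((∑ b, (B b r : ℂ) • majorana (i, b)) * U) by
    obtain ⟨U, ε, hε, hU, hloc, hP, hc⟩ := h
    refine ⟨U, isLocalUnitary_of_intertwine hB hε hU hloc hP hc, fun r => ?_⟩
    have hε2 : (ε : ℂ) * ε = 1 := by rcases hε with rfl | rfl <;> norm_num
    rw [← mul_assoc, hP, smul_mul_assoc, mul_assoc, hc, mul_smul_comm, smul_smul, hε2, one_smul,
      mul_assoc]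
  have hBB := (Matrix.mem_orthogonalGroup_iff (Fin 2) ℝ).mp hB
  have hent : ∀ a b, B a 0 * B b 0 + B a 1 * B b 1 = if a = b then 1 else 0 := by
    intro a b
    have := congrFun (congrFun hBB a) b
    rwa [Matrix.mul_apply, Fin.sum_univ_two, Matrix.one_apply] at this
  have h00 := hent 0 0
  have h01 := hent 0 1
  have h11 := hent 1 1
  simp only [if_true, zero_ne_one, if_false] at h00 h01 h11
  obtain ⟨x, y, hxy, hc, hs⟩ := exists_half_angle h00
  set c := majorana (i, (0 : Fin 2)) with hcd
  set d := majorana (i, (1 : Fin 2)) with hdd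
  have hcm : c ∈ modeAlgebra {i} := majorana_mem_modeAlgebra (by simp) 0
  have hdm : d ∈ modeAlgebra {i} := majorana_mem_modeAlgebra (by simp) 1
  have hcc : c * c = 1 := majorana_sq _
  have hdd' : d * d = 1 := majorana_sq _
  have hdc : d * c = -(c * d) := majorana_anticomm (by simp)
  have hcs : cᴴ = c := majorana_conjTranspose _
  have hds : dᴴ = d := majorana_conjTranspose _
  have hPc : parity n * c = -(c * parity n) := parity_mul_majorana _
  have hPd : parity n * d = -(d * parity n) := parity_mul_majorana _
  have hcdc : c * d * c = -d := by rw [mul_assoc, hdc, mul_neg, ← mul_assoc, hcc, one_mul]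
  have hcdd : c * d * d = c := by rw [mul_assoc, hdd', mul_one]
  have hccd : c * (c * d) = d := by rw [← mul_assoc, hcc, one_mul]
  have hdcd : d * (c * d) = -c := by rw [← mul_assoc, hdc, neg_mul, hcdd]
  have hcdcd : c * d * (c * d) = -1 := by rw [mul_assoc, hdcd, mul_neg, hcc]
  have hX : ((x * x + y * y : ℝ) : ℂ) = 1 := by rw [hxy]; norm_num
  push_cast at hX
  have hC : (B 0 0 : ℂ) = x * x - y * y := by rw [← hc]; push_cast; ring
  have hS : (B 0 1 : ℂ) = 2 * (x * y) := by rw [← hs]; push_cast; ring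
  have hdet : (B 0 0 * B 1 1 - B 0 1 * B 1 0) * (B 0 0 * B 1 1 - B 0 1 * B 1 0) = 1 := by
    linear_combination (B 1 0 * B 1 0 + B 1 1 * B 1 1) * h00 + h11 -
      (B 0 0 * B 1 0 + B 0 1 * B 1 1) * h01
  have e11 : (B 0 0 * B 1 1 - B 0 1 * B 1 0) * B 0 0 = B 1 1 := by
    linear_combination B 1 1 * h00 - B 0 1 * h01
  have e10 : (B 0 0 * B 1 1 - B 0 1 * B 1 0) * B 0 1 = - B 1 0 := by
    linear_combination -B 1 0 * h00 + B 0 0 * h01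
  rcases mul_self_eq_one_iff.mp hdet with hd1 | hd1
  · rw [hd1, one_mul] at e11 e10
    have hC' : (B 1 1 : ℂ) = x * x - y * y := by rw [← e11, hC]
    have hS' : (B 1 0 : ℂ) = -(2 * (x * y)) := by rw [← hS, e10]; push_cast; ring
    -- Determinant 1: a rotation is implemented by the even spin element with half the angle.
    refine ⟨(x : ℂ) • 1 + (y : ℂ) • (c * d), 1, Or.inl rfl, ?_, ?_, ?_, ?_⟩
    · rw [Matrix.mem_unitaryGroup_iff', Matrix.star_eq_conjTranspose, Matrix.conjTranspose_add,
        Matrix.conjTranspose_smul, Matrix.conjTranspose_smul, Matrix.conjTranspose_mul, hcs, hds,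
        Matrix.conjTranspose_one, hdc]
      simp only [mul_add, add_mul, smul_mul_smul_comm, neg_mul, hcdcd, one_mul, mul_one,
        RCLike.star_def, Complex.conj_ofReal, neg_neg]
      match_scalars
      · linear_combination hX
      · ring
    · exact Subalgebra.add_mem _ (Subalgebra.smul_mem _ (Subalgebra.one_mem _) _)
        (Subalgebra.smul_mem _ (Subalgebra.mul_mem _ hcm hdm) _)
    · have h1 : c * d * parity n = parity n * (c * d) := by
        rw [← mul_assoc (parity n), hPc, neg_mul, mul_assoc c (parity n), hPd, mul_neg, neg_neg,
          mul_assoc]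
      simp only [add_mul, mul_add, smul_mul_assoc, mul_smul_comm, one_mul, mul_one, h1,
        Complex.ofReal_one, one_smul]
    · rw [Fin.forall_fin_two]
      simp only [Fin.sum_univ_two, ← hcd, ← hdd, hC, hS, hC', hS', add_mul, mul_add,
        smul_mul_assoc, mul_smul_comm, one_mul, mul_one, hcdc, hcdd, hccd, hdcd,
        Complex.ofReal_one, one_smul]
      constructor
      · match_scalars
        · linear_combination (-(x : ℂ)) * hX
        · linear_combination (y : ℂ) * hX
      · match_scalars
        · linear_combination (-(x : ℂ)) * hX
        · linear_combination (-(y : ℂ)) * hX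
  · rw [hd1, neg_one_mul] at e11 e10
    have hC' : (B 1 1 : ℂ) = -(x * x - y * y) := by rw [← e11, ← hC]; push_cast; ring
    have hS' : (B 1 0 : ℂ) = 2 * (x * y) := by rw [← hS, neg_inj.mp e10]
    -- Determinant -1: a reflection, up to the sign ε = -1, is implemented by an odd unit vector,
    -- again at half the angle.
    refine ⟨(x : ℂ) • d - (y : ℂ) • c, -1, Or.inr rfl, ?_, ?_, ?_, ?_⟩
    · rw [Matrix.mem_unitaryGroup_iff', Matrix.star_eq_conjTranspose, Matrix.conjTranspose_sub,
        Matrix.conjTranspose_smul, Matrix.conjTranspose_smul, hcs, hds]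
      simp only [mul_sub, sub_mul, smul_mul_smul_comm, hcc, hdd', hdc, RCLike.star_def,
        Complex.conj_ofReal]
      match_scalars
      · linear_combination hX
      · ring
    · exact Subalgebra.sub_mem _ (Subalgebra.smul_mem _ hdm _) (Subalgebra.smul_mem _ hcm _)
    · simp only [sub_mul, mul_sub, smul_mul_assoc, mul_smul_comm, hPc, hPd]
      push_cast
      module
    · rw [Fin.forall_fin_two]
      simp only [Fin.sum_univ_two, ← hcd, ← hdd, hC, hS, hC', hS', add_mul, sub_mul, mul_sub,
        smul_mul_assoc, mul_smul_comm, hcc, hdd', hdc]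
      push_cast
      constructor
      · match_scalars
        · linear_combination (x : ℂ) * hX
        · linear_combination (y : ℂ) * hX
      · match_scalars
        · linear_combination (-(x : ℂ)) * hX
        · linear_combination (y : ℂ) * hX

end

/-! ### From intertwining relations to conjugation by the product unitary -/

section

variable {n : ℕ}

lemma list_prod_mul_eq_mul_list_prod {ι A : Type*} [Monoid A] {U : ι → A} {y z : A} {i : ι}
    (hi : U i * y = z * U i) (hy : ∀ j, j ≠ i → Commute (U j) y)
    (hz : ∀ j, j ≠ i → Commute (U j) z) (l : List ι) (hl : l.Nodup) (h : i ∈ l) :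
    (l.map U).prod * y = z * (l.map U).prod := by
  induction l with
  | nil => simp at h
  | cons j l ih =>
    rw [List.nodup_cons] at hl
    rw [List.map_cons, List.prod_cons, mul_assoc]
    by_cases hj : j = i
    · subst hj
      have h1 : Commute (l.map U).prod y := by
        refine (Commute.list_prod_right _ _ fun f hf => ?_).symm
        obtain ⟨k, hk, rfl⟩ := List.mem_map.mp hf
        refine (hy k ?_).symm
        rintro rfl
        exact hl.1 hk
      rw [h1.eq, ← mul_assoc, hi, mul_assoc]
    · rw [List.mem_cons] at h
      rw [ih hl.2 (h.resolve_left (Ne.symm hj)), ← mul_assoc, (hz j hj).eq, mul_assoc]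

lemma exists_smul_one_of_forall_commute {Z : Op n} (h : ∀ Y, Commute Y Z) :
    ∃ a : ℂ, Z = a • 1 := by
  obtain ⟨a, ha⟩ := Matrix.mem_range_scalar_of_commute_single fun i j _ => h (Matrix.single i j 1)
  refine ⟨a, ?_⟩
  rw [← ha, Matrix.scalar_apply, Matrix.smul_one_eq_diagonal]

/-- A trace-preserving map commuting with left and right multiplication by `P c_p` is the
identity. -/
lemma eq_self_of_intertwine {F : Op n →ₗ[ℂ] Op n} (htr : (F 1).trace = (1 : Op n).trace)
    (hl : ∀ p X, F (parity n * majorana p * X) = parity n * majorana p * F X)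
    (hr : ∀ p X, F (X * (parity n * majorana p)) = F X * (parity n * majorana p)) (X : Op n) :
    F X = X := by
  let L : Subalgebra ℂ (Op n) :=
    { carrier := {Y | ∀ X, F (Y * X) = Y * F X}
      mul_mem' := fun {a b} ha hb X => by rw [mul_assoc, ha, hb, mul_assoc]
      add_mem' := fun {a b} ha hb X => by rw [add_mul, map_add, ha, hb, add_mul]
      algebraMap_mem' := fun r X => by
        rw [← Algebra.smul_def, ← Algebra.smul_def, map_smul] }
  let R : Subalgebra ℂ (Op n) :=
    { carrier := {Y | ∀ X, F (X * Y) = F X * Y}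
      mul_mem' := fun {a b} ha hb X => by rw [← mul_assoc, hb, ha, mul_assoc]
      add_mem' := fun {a b} ha hb X => by rw [mul_add, map_add, ha, hb, mul_add]
      algebraMap_mem' := fun r X => by
        rw [← Algebra.commutes, ← Algebra.commutes, ← Algebra.smul_def, ← Algebra.smul_def,
          map_smul] }
  have hL : L = ⊤ := eq_top_of_parity_mul_majorana_mem hl
  have hR : R = ⊤ := eq_top_of_parity_mul_majorana_mem hr
  have hL' : ∀ Y, F Y = Y * F 1 := fun Y => by
    have : Y ∈ L := by simp [hL]
    simpa using this 1
  have hR' : ∀ Y, F Y = F 1 * Y := fun Y => by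
    have : Y ∈ R := by simp [hR]
    simpa using this 1
  obtain ⟨a, ha⟩ := exists_smul_one_of_forall_commute (Z := F 1) fun Y =>
    (hL' Y).symm.trans (hR' Y)
  have h1 : (1 : Op n).trace ≠ 0 := by
    rw [Matrix.trace_one]
    exact_mod_cast Fintype.card_ne_zero
  have ha1 : a = 1 := by
    rw [ha, Matrix.trace_smul, smul_eq_mul] at htr
    exact (mul_eq_right₀ h1).mp htr
  rw [hL', ha, ha1, one_smul, mul_one]

/-- `E` and conjugation by `V` carry P c_p to the same rotated operators on both sides. Undoing the
conjugation gives a trace-preserving map that commutes with all multiplications by P c_p, and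
`eq_self_of_intertwine` applies. -/
lemma eq_conj_of_intertwine {E : Op n →ₗ[ℂ] Op n} (htr : ∀ X, (E X).trace = X.trace)
    {V : Op n} (hV : V ∈ Matrix.unitaryGroup (Occ n) ℂ) {d : Fin n × Fin 2 → Op n}
    (hP : ∀ p, d p * parity n = -(parity n * d p))
    (hd : ∀ p, V * (parity n * majorana p) = parity n * d p * V)
    (hl : ∀ p X, d p * E X = parity n * E (parity n * majorana p * X))
    (hr : ∀ p X, E X * d p = E (X * (majorana p * parity n)) * parity n) (X : Op n) :
    E X = V * X * Vᴴ := by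
  have h1 : Vᴴ * V = 1 := Matrix.mem_unitaryGroup_iff'.mp hV
  have h2 : V * Vᴴ = 1 := Matrix.mem_unitaryGroup_iff.mp hV
  have hd' : ∀ p, Vᴴ * (parity n * d p) = parity n * majorana p * Vᴴ := by
    intro p
    calc Vᴴ * (parity n * d p) = Vᴴ * (parity n * d p * V) * Vᴴ := by
          rw [mul_assoc Vᴴ, mul_assoc _ V, h2, mul_one]
      _ = _ := by rw [← hd, ← mul_assoc Vᴴ, h1, one_mul]
  have hl' : ∀ p X, E (parity n * majorana p * X) = parity n * d p * E X := by
    intro p X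
    rw [mul_assoc (parity n) (d p), hl, ← mul_assoc, parity_sq, one_mul]
  have hr' : ∀ p X, E (X * (parity n * majorana p)) = E X * (parity n * d p) := by
    intro p X
    have h3 := hr p X
    rw [parity_mul_majorana, mul_neg, map_neg, ← neg_eq_iff_eq_neg.mpr (hP p), mul_neg,
      ← mul_assoc (E X), h3, mul_assoc, parity_sq, mul_one]
  let F : Op n →ₗ[ℂ] Op n := LinearMap.mulRight ℂ V ∘ₗ LinearMap.mulLeft ℂ Vᴴ ∘ₗ E
  have hF : ∀ X, F X = Vᴴ * E X * V := fun X => rfl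
  have hFX : F X = X := by
    refine eq_self_of_intertwine ?_ (fun p X => ?_) (fun p X => ?_) X
    · rw [hF, Matrix.trace_mul_comm, ← mul_assoc, h2, one_mul, htr]
    · rw [hF, hF, hl', ← mul_assoc, hd']
      simp only [mul_assoc]
    · rw [hF, hF, hr', mul_assoc, mul_assoc (E X), ← hd, mul_assoc Vᴴ, mul_assoc Vᴴ, mul_assoc (E X)]
  have := congrArg (fun A => V * A * Vᴴ) hFX
  simp only [hF] at this
  rw [← this]
  calc E X = (V * Vᴴ) * E X * (V * Vᴴ) := by rw [h2, one_mul, mul_one]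
    _ = _ := by simp only [mul_assoc]

end

end Fermion

theorem mainTheorem3 (n : ℕ) (hn : 2 ≤ n)
    (E : Fermion.Op n →ₗ[ℂ] Fermion.Op n) (hE : Fermion.IsGaussianSeparable E)
    (Ψ Φ : Fermion.Occ n → ℂ)
    (hΨ : Fermion.IsPureState Ψ) (hΦ : Fermion.IsPureState Φ)
    (hΦent : Fermion.FullyEntangled Φ)
    (hmap : E (Fermion.proj Ψ) = Fermion.proj Φ) :
    ∃ U : Fin n → Fermion.Op n, (∀ i, Fermion.IsLocalUnitary i (U i)) ∧
      ∀ ρ : Fermion.Op n, E ρ = (List.ofFn U).prod * ρ * ((List.ofFn U).prod)ᴴ := by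
  open Fermion in
  choose B hB hBE using hE.exists_orthogonal hn hΦ hΦent hmap
  choose U hU hUB using fun i => exists_localUnitary i (hB i)
  refine ⟨U, hU, ?_⟩
  -- The parity twist makes the operators of party `i` commute with the unitaries of all other
  -- parties, even odd ones, so no signs accumulate in the product.
  have hcomm : ∀ i j, j ≠ i → ∀ a, Commute (U j) (parity n * majorana (i, a)) := fun i j hij a =>
    (commute_parity_mul_majorana (by simpa using hij.symm) a (hU j).loc).symm
  refine eq_conj_of_intertwine hE.tracePreserving ?_
    (d := fun p => ∑ b, (B p.1 b p.2 : ℂ) • majorana (p.1, b)) (fun p => ?_) (fun p => ?_)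
    (fun p X => (hBE p.1 p.2 X).1) (fun p X => (hBE p.1 p.2 X).2)
  · refine list_prod_mem fun V hV => ?_
    obtain ⟨i, rfl⟩ := (List.mem_ofFn' _ _).mp hV
    exact (hU i).unitary
  · simp only [Finset.mul_sum, Finset.sum_mul, mul_smul_comm, smul_mul_assoc, parity_mul_majorana,
      smul_neg, Finset.sum_neg_distrib, neg_neg]
  · rw [List.ofFn_eq_map]
    refine list_prod_mul_eq_mul_list_prod (hUB p.1 p.2) (fun j hj => hcomm p.1 j hj p.2)
      (fun j hj => ?_) _ (List.nodup_finRange n) (List.mem_finRange _)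
    rw [Finset.mul_sum]
    refine Commute.sum_right _ _ _ fun b _ => ?_
    rw [mul_smul_comm]
    exact (hcomm p.1 j hj b).smul_right _
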